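/- **Setting.** Let $d\in\mathbb N$, let $\mathfrak L$ be a finite set of edge types, and let each $\mathfrak t\in\mathfrak L$ have a homogeneity $|\mathfrak t|\in\mathbb R$. Let $\boldsymbol{\mathcal B}$ be the set of isomorphism classes of finite rooted trees whose edges carry a type in $\mathfrak L$ and a decoration $\mathfrak e\in\mathbb N^d$, and whose nodes carry decorations $\mathfrak n\in\mathbb N^d$ and $\mathfrak o\in\mathbb Z^d\oplus\mathbb Z(\mathfrak L)$. The homogeneity $|\tau|=|\mathfrak n|+|\mathfrak o|-|\mathfrak e|+|\mathfrak t|$ sums the decorations over all nodes and edges, where $|k|=\sum_i k_i$ for $k\in\mathbb N^d$ and $|(a,c)|=\sum_i a_i+\sum_{\mathfrak t}c_{\mathfrak t}|\mathfrak t|$ on $\mathbb Z^d\oplus\mathbb Z(\mathfrak L)$. Let $X^k$ be the one-node tree with $\mathfrak n=k$, $\mathfrak o=0$, and $\mathbf 1=X^0$; let $\tau\sigma$ be the tree product (the roots are identified, their decorations added); let $I_k^{\mathfrak t}(\tau)$ be $\tau$ with a new undecorated root joined to the old one by an edge of type $\mathfrak t$ with $\mathfrak e=k$; let $R_\alpha$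 add $\alpha$ to $\mathfrak o$ at the root. Put $\boldsymbol T=\mathrm{span}_{\mathbb R}(\boldsymbol{\mathcal B})$ and extend these operations linearly. Let $\boldsymbol T^+$ be the commutative algebra freely generated by $X_1,\dots,X_d$ and the symbols $I_k^{\mathfrak t}(\tau)$ with $|\tau|+|\mathfrak t|-|k|>0$. The coproduct is the linear map $\Delta:\boldsymbol T\to\boldsymbol T\otimes\boldsymbol T^+$ determined by $$\Delta\mathbf 1=\mathbf 1\otimes\mathbf 1,\quad \Delta X_i=X_i\otimes\mathbf 1+\mathbf 1\otimes X_i,\quad \Delta(\tau\sigma)=(\Delta\tau)(\Delta\sigma),\quad \Delta R_\alpha(\tau)=(R_\alpha\otimes\mathrm{Id})\Delta\tau,$$ $$\Delta I_k^{\mathfrak t}(\tau)=(I_k^{\mathfrak t}\otimes\mathrm{Id})\Delta\tau+\sum_{|\ell|+|k|<|\tau|+|\mathfrak t|}\frac{X^\ell}{\ell!}\otimes I_{k+\ell}^{\mathfrak t}(\tau)\qquad(\tau\in\boldsymbol{\mathcal B}).$$ Fix a normal rule: for each $\mathfrak t\in\mathfrak L$, a set $\mathcal R(\mathfrak t)$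 of pairs $(N,\alpha)$, with $N$ a finite multiset of edge labels in $\mathfrak L\times\mathbb N^d$ and $\alpha\in\mathbb Z^d\oplus\mathbb Z(\mathfrak L)$, such that $(N,\alpha)\in\mathcal R(\mathfrak t)$ and $M\subset N$ imply $(M,\alpha)\in\mathcal R(\mathfrak t)$. (For a usual normal rule $\mathcal R_0$ one takes all $(N,\alpha)$ with $N\in\mathcal R_0(\mathfrak t)$ and $\alpha$ non-positive.) A tree $\tau$ conforms above $\mathfrak t$ if at each of its nodes the pair (multiset of the labels of the upward edges, $\mathfrak o$-decoration) belongs to $\mathcal R(\mathfrak t')$, where $\mathfrak t'$ is the type of the edge below the node, and $\mathfrak t'=\mathfrak t$ at the root. It strongly conforms if it conforms above some $\mathfrak t$. Let $T_{\mathrm{BHZ}}\subset\boldsymbol T$ be the span of the strongly conforming trees, and $T^+_{\mathrm{BHZ}}\subset\boldsymbol T^+$ the subalgebra generated by the $X_i$ and those generators $I_k^{\mathfrak t}(\tau)$ for which $\tau$ conforms above $\mathfrak t$. Then $\Delta$ restricts to $\Delta:T_{\mathrm{BHZ}}\to T_{\mathrm{BHZ}}\otimes T_{\mathrm{BHZ}}^+$.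 For $\ell,k\in\mathbb N^d$, $\mathfrak t\in\mathfrak L$ and $\tau\in\boldsymbol T$, set $${}_\ell I_k^{\mathfrak t}(\tau)=\sum_{m\le\ell}\binom{\ell}{m}X^m(-1)^{|\ell-m|}I_k^{\mathfrak t}\big(X^{\ell-m}\tau\big).$$ Let $\widetilde{\boldsymbol{\mathcal B}}_\bullet\subset\boldsymbol T$ be the smallest set that contains $\mathbf 1$ and is stable under all ${}_\ell I_k^{\mathfrak t}$, all $R_\alpha$ and the tree product. Set $\widetilde{\boldsymbol{\mathcal B}}=\{X^k\tau:\ k\in\mathbb N^d,\ \tau\in\widetilde{\boldsymbol{\mathcal B}}_\bullet\}$, $\widetilde{\mathcal B}=\widetilde{\boldsymbol{\mathcal B}}\cap T_{\mathrm{BHZ}}$ and $\widetilde{\mathcal B}_\bullet=\widetilde{\boldsymbol{\mathcal B}}_\bullet\cap\widetilde{\mathcal B}$. **Theorem.** The set $\widetilde{\mathcal B}$ is a linear basis of $T_{\mathrm{BHZ}}$ that consists of homogeneous elements, and $(k,\tau)\mapsto X^k\tau$ is a bijection from $\mathbb N^d\times\widetilde{\mathcal B}_\bullet$ onto $\widetilde{\mathcal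 B}$. This basis satisfies assumption (D): for all $\tau\in\widetilde{\mathcal B}_\bullet$, $\sigma\in\widetilde{\mathcal B}$ and $k\in\mathbb N^d\setminus\{0\}$, the coefficient of $\sigma\otimes X^k$ is zero in the expansion of $\Delta\tau$ in the basis of $T_{\mathrm{BHZ}}\otimes T^+_{\mathrm{BHZ}}$ formed by the $\sigma'\otimes\eta$, with $\sigma'\in\widetilde{\mathcal B}$ and $\eta$ a monomial in the free generators of $T^+_{\mathrm{BHZ}}$. -/

import Mathlib

open scoped TensorProduct

namespace BHZ

/-! ### Decorated rooted trees -/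

/-- Multi-indices `k ∈ ℕ^d`. -/
abbrev MI (d : ℕ) : Type := Fin d →₀ ℕ

namespace MI

variable {d : ℕ}

/-- `|k| = ∑ i, k i`. -/
def size (k : MI d) : ℕ := ∑ i, k i

/-- The multi-index binomial coefficient `∏ i, (k i choose m i)`. -/
def binom (k m : MI d) : ℕ := ∏ i, (k i).choose (m i)

/-- The multi-index factorial `k! = ∏ i, (k i)!`. -/
def factorial (k : MI d) : ℕ := ∏ i, (k i).factorial

theorem finite_size_lt (r : ℝ) : {k : MI d | (size k : ℝ) < r}.Finite := by
  refine (Set.finite_Iic (Finsupp.equivFunOnFinite.symm fun _ => ⌈r⌉₊ : MI d)).subset ?_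
  intro k hk i
  have h1 : k i ≤ size k :=
    Finset.single_le_sum (f := fun j => k j) (fun _ _ => Nat.zero_le _) (Finset.mem_univ i)
  have h2 : (size k : ℝ) < r := hk
  have h3 : (size k : ℝ) ≤ (⌈r⌉₊ : ℝ) := h2.le.trans (Nat.le_ceil r)
  exact h1.trans (by exact_mod_cast h3)

/-- The finite set of the multi-indices `k` with `|k| < r`. -/
noncomputable def below (r : ℝ) : Finset (MI d) := (finite_size_lt (d := d) r).toFinset

end MI

/-- The extended decorations: elements of `ℤ^d ⊕ ℤ(𝔏)`. -/
abbrev ODec (d : ℕ) (L : Type) : Type := (Fin d → ℤ) × (L → ℤ)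

/-- The label of an edge: its type `𝔱 ∈ 𝔏` and its decoration `𝔢 ∈ ℕ^d`. -/
abbrev Edge (d : ℕ) (L : Type) : Type := L × MI d

/-- The data of a decorated rooted tree, seen from its root: the decorations `𝔫` and `𝔬` of the root,
and the finite multiset of the branches at the root. A branch is an edge label together with
an element of `α`, which stands for the subtree above that edge. -/
def TreeShape (d : ℕ) (L : Type) (α : Type) : Type :=
  (MI d × ODec d L) × Multiset (Edge d L × α)

instance TreeShape.instFunctor (d : ℕ) (L : Type) : Functor (TreeShape d L) where
  map f x := (x.1, x.2.map fun b => (b.1, f b.2))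

/-- `TreeShape` is a quotient of a polynomial functor: a multiset is a list up to permutation. -/
noncomputable instance TreeShape.instQPF (d : ℕ) (L : Type) : QPF (TreeShape d L) where
  P := ⟨(MI d × ODec d L) × List (Edge d L), fun a => Fin a.2.length⟩
  abs := fun p => (p.1.1, Multiset.ofList (List.ofFn fun i => (p.1.2.get i, p.2 i)))
  repr := fun x => ⟨(x.1, x.2.toList.map Prod.fst),
    fun i => (x.2.toList.get (i.cast (List.length_map _))).2⟩
  abs_repr := by
    rintro α ⟨a, s⟩
    refine Prod.ext rfl ?_
    show Multiset.ofList (List.ofFn _) = s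
    conv_rhs => rw [← Multiset.coe_toList s]
    congr 1
    apply List.ext_get
    · simp
    · intro n h1 h2
      simp
  abs_map := by
    rintro α β f ⟨⟨a, l⟩, g⟩
    refine Prod.ext rfl ?_
    show Multiset.ofList (List.ofFn _) = Multiset.map _ (Multiset.ofList (List.ofFn _))
    rw [Multiset.map_coe, List.map_ofFn]
    rfl

/-- Decorated rooted trees, up to isomorphism: the least fixed point of `TreeShape`, that is, a tree
is a root with its decorations and a finite multiset of branches, which are labelled edges
with a tree above each. -/
def Tree (d : ℕ) (L : Type) : Type := QPF.Fix (TreeShape d L)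

namespace Tree

variable {d : ℕ} {L : Type}

/-- The tree with root decorations `𝔫 = n`, `𝔬 = o` and with the multiset `s` of branches. -/
noncomputable def node (n : MI d) (o : ODec d L) (s : Multiset (Edge d L × Tree d L)) : Tree d L :=
  QPF.Fix.mk (F := TreeShape d L) ((n, o), s)

/-- The decorations of the root and the branches at the root. -/
noncomputable def dest (τ : Tree d L) : (MI d × ODec d L) × Multiset (Edge d L × Tree d L) :=
  QPF.Fix.dest (F := TreeShape d L) τ

theorem dest_node (n : MI d) (o : ODec d L) (s : Multiset (Edge d L × Tree d L)) :
    (node n o s).dest = ((n, o), s) := QPF.Fix.dest_mk (F := TreeShape d L) _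

theorem node_dest (τ : Tree d L) : node τ.dest.1.1 τ.dest.1.2 τ.dest.2 = τ :=
  QPF.Fix.mk_dest (F := TreeShape d L) τ

/-- Induction on trees. -/
theorem ind {p : Tree d L → Prop}
    (h : ∀ n o s, (∀ b ∈ s, p b.2) → p (node n o s)) (τ : Tree d L) : p τ := by
  refine QPF.Fix.ind (F := TreeShape d L) p ?_ τ
  rintro x ⟨u, rfl⟩
  refine h u.1.1 u.1.2 (u.2.map fun b => (b.1, b.2.1)) ?_
  intro b hb
  obtain ⟨c, -, rfl⟩ := Multiset.mem_map.1 hb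
  exact c.2.2

/-- Recursion on trees, from the values on the subtrees above the branches at the root. -/
noncomputable def fold {α : Type} (g : MI d → ODec d L → Multiset (Edge d L × α) → α) :
    Tree d L → α :=
  QPF.Fix.rec (F := TreeShape d L) fun x => g x.1.1 x.1.2 x.2

theorem fold_node {α : Type} (g : MI d → ODec d L → Multiset (Edge d L × α) → α)
    (n : MI d) (o : ODec d L) (s : Multiset (Edge d L × Tree d L)) :
    fold g (node n o s) = g n o (s.map fun b => (b.1, fold g b.2)) :=
  QPF.Fix.rec_eq (F := TreeShape d L) _ _

/-- The tree product: the two roots are identified, and their decorations are added. -/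
noncomputable instance : CommMonoid (Tree d L) where
  mul τ σ := node (τ.dest.1.1 + σ.dest.1.1) (τ.dest.1.2 + σ.dest.1.2) (τ.dest.2 + σ.dest.2)
  one := node 0 0 0
  mul_assoc a b c := by
    show node _ _ _ = node _ _ _
    simp only [HMul.hMul, dest_node, add_assoc]
  one_mul a := by
    show node _ _ _ = a
    conv_rhs => rw [← node_dest a]
    simp only [OfNat.ofNat, One.one, dest_node]
    congr 1 <;> exact zero_add _
  mul_one a := by
    show node _ _ _ = a
    conv_rhs => rw [← node_dest a]
    simp only [OfNat.ofNat, One.one, dest_node]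
    congr 1 <;> exact add_zero _
  mul_comm a b := by
    show node _ _ _ = node _ _ _
    congr 1 <;> exact add_comm _ _

theorem one_def : (1 : Tree d L) = node 0 0 0 := rfl

theorem node_mul_node (n n' : MI d) (o o' : ODec d L) (s s' : Multiset (Edge d L × Tree d L)) :
    node n o s * node n' o' s' = node (n + n') (o + o') (s + s') := by
  show node _ _ _ = _
  simp only [dest_node]

/-- The one-node tree `X^k`. -/
noncomputable def X (k : MI d) : Tree d L := node k 0 0

/-- `I_k^𝔱(τ)`: a new root, joined to the root of `τ` by an edge of type `𝔱`, decorated by `k`. -/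
noncomputable def I (t : L) (k : MI d) (τ : Tree d L) : Tree d L := node 0 0 {((t, k), τ)}

/-- `R_α(τ)`: the value `α` is added to the decoration `𝔬` of the root of `τ`. -/
noncomputable def R (α : ODec d L) (τ : Tree d L) : Tree d L :=
  node τ.dest.1.1 (τ.dest.1.2 + α) τ.dest.2

/-- The homogeneity `|α|` of an element of `ℤ^d ⊕ ℤ(𝔏)`, for the homogeneities `w` of the types. -/
noncomputable def oSize [Fintype L] (w : L → ℝ) (α : ODec d L) : ℝ :=
  ∑ i, (α.1 i : ℝ) + ∑ t, (α.2 t : ℝ) * w t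

/-- The homogeneity `|τ| = |𝔫| + |𝔬| - |𝔢| + |𝔱|`: sums over all nodes and all edges of `τ`. -/
noncomputable def deg [Fintype L] (w : L → ℝ) : Tree d L → ℝ :=
  fold fun n o s => (MI.size n : ℝ) + oSize w o + (s.map fun b => w b.1.1 - MI.size b.1.2 + b.2).sum

theorem deg_node [Fintype L] (w : L → ℝ) (n : MI d) (o : ODec d L)
    (s : Multiset (Edge d L × Tree d L)) :
    deg w (node n o s) =
      MI.size n + oSize w o + (s.map fun b => w b.1.1 - MI.size b.1.2 + deg w b.2).sum := by
  rw [deg, fold_node, Multiset.map_map]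
  rfl

end Tree

/-! ### The space spanned by all trees -/

section Space

variable (d : ℕ) (L : Type)

/-- `𝑻`, the real vector space with the basis of all decorated trees; it is an algebra for
the tree product. -/
abbrev T : Type := MonoidAlgebra ℝ (Tree d L)

end Space

namespace T

variable {d : ℕ} {L : Type}

/-- The linear extension of a map that is defined on trees. -/
noncomputable def extend {V : Type} [AddCommGroup V] [Module ℝ V] (f : Tree d L → V) :
    T d L →ₗ[ℝ] V :=
  (MonoidAlgebra.basis (Tree d L) ℝ).constr ℝ f

theorem extend_of {V : Type} [AddCommGroup V] [Module ℝ V] (f : Tree d L → V) (τ : Tree d L) :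
    extend f (MonoidAlgebra.of ℝ _ τ) = f τ := by
  have := (MonoidAlgebra.basis (Tree d L) ℝ).constr_basis ℝ f τ
  simpa [extend] using this

/-- `X^k` as an element of `𝑻`. -/
noncomputable def X (k : MI d) : T d L := MonoidAlgebra.of ℝ _ (Tree.X k)

/-- The operator `I_k^𝔱` on `𝑻`. -/
noncomputable def I (t : L) (k : MI d) : T d L →ₗ[ℝ] T d L :=
  extend fun τ => MonoidAlgebra.of ℝ _ (Tree.I t k τ)

/-- The operator `R_α` on `𝑻`. -/
noncomputable def R (α : ODec d L) : T d L →ₗ[ℝ] T d L :=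
  extend fun τ => MonoidAlgebra.of ℝ _ (Tree.R α τ)

theorem R_apply (α : ODec d L) (v : T d L) :
    R α v = MonoidAlgebra.of ℝ _ (Tree.node 0 α 0) * v := by
  have : R α = LinearMap.mulLeft ℝ (MonoidAlgebra.of ℝ _ (Tree.node 0 α 0) : T d L) := by
    refine (MonoidAlgebra.basis (Tree d L) ℝ).ext fun τ => ?_
    show R α (MonoidAlgebra.of ℝ _ τ) = MonoidAlgebra.of ℝ _ _ * MonoidAlgebra.of ℝ _ τ
    rw [R, extend_of, ← map_mul]
    congr 1
    conv_rhs => rw [← Tree.node_dest τ]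
    rw [Tree.node_mul_node, zero_add, zero_add, add_comm, Tree.R]
  rw [this, LinearMap.mulLeft_apply]

/-- The operator `_ℓ I_k^𝔱(v) = ∑_m (ℓ choose m) X^m (-1)^{ℓ-m} I_k^𝔱(X^{ℓ-m} v)`; the pair `p` below
is `(m, ℓ - m)`. -/
noncomputable def twistedI (l : MI d) (t : L) (k : MI d) (v : T d L) : T d L :=
  ∑ p ∈ Finset.HasAntidiagonal.antidiagonal l,
    ((MI.binom l p.1 : ℝ) * (-1) ^ MI.size p.2) • (X p.1 * I t k (X p.2 * v))

/-- The set `𝑩̃_•`. -/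
inductive TildeBullet : T d L → Prop
  | one : TildeBullet 1
  | twistedI (l : MI d) (t : L) (k : MI d) (v : T d L) :
      TildeBullet v → TildeBullet (T.twistedI l t k v)
  | R (α : ODec d L) (v : T d L) : TildeBullet v → TildeBullet (T.R α v)
  | mul (u v : T d L) : TildeBullet u → TildeBullet v → TildeBullet (u * v)

/-- The set `𝑩̃ = {X^k v ; k ∈ ℕ^d, v ∈ 𝑩̃_•}`. -/
def Tilde (v : T d L) : Prop := ∃ (k : MI d) (u : T d L), TildeBullet u ∧ v = X k * u

/-- `v` is homogeneous of homogeneity `β`: all the trees that occur in `v` have homogeneity `β`. -/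
def IsHomogeneous [Fintype L] (w : L → ℝ) (β : ℝ) (v : T d L) : Prop :=
  ∀ τ ∈ v.coeff.support, Tree.deg w τ = β

end T

/-! ### The coproduct on the space spanned by all trees -/

section Coproduct

variable {d : ℕ} {L : Type} [Fintype L] (w : L → ℝ)

/-- The labels of the planted trees `I_k^𝔱(τ)` with positive homogeneity. -/
abbrev PosPlanted (d : ℕ) {L : Type} [Fintype L] (w : L → ℝ) : Type :=
  {p : Edge d L × Tree d L // 0 < Tree.deg w p.2 + w p.1.1 - MI.size p.1.2}

/-- `𝑻⁺`, the commutative algebra freely generated by `X_1, …, X_d` and by the planted trees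
with positive homogeneity. -/
abbrev TPlus (d : ℕ) {L : Type} [Fintype L] (w : L → ℝ) : Type :=
  MvPolynomial (Fin d ⊕ PosPlanted d w) ℝ

open Classical in
/-- `I_k^𝔱(τ)` as an element of `𝑻⁺`; it is `0` unless its homogeneity is positive. -/
noncomputable def TPlus.I (t : L) (k : MI d) (τ : Tree d L) : TPlus d w :=
  if h : 0 < Tree.deg w τ + w t - MI.size k then MvPolynomial.X (Sum.inr ⟨((t, k), τ), h⟩) else 0

/-- `Δ X^k = ∏ i, (X_i ⊗ 1 + 1 ⊗ X_i)^{k i}`. -/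
noncomputable def deltaX (k : MI d) : T d L ⊗[ℝ] TPlus d w :=
  ∏ i, (T.X (Finsupp.single i 1) ⊗ₜ[ℝ] 1 + 1 ⊗ₜ[ℝ] MvPolynomial.X (Sum.inl i)) ^ k i

/-- `Δ I_k^𝔱(τ) = (I_k^𝔱 ⊗ Id) Δτ + ∑_{|ℓ| + |k| < |τ| + |𝔱|} X^ℓ / ℓ! ⊗ I_{k+ℓ}^𝔱(τ)`,
with `D` for `Δτ`. -/
noncomputable def deltaI (t : L) (k : MI d) (τ : Tree d L) (D : T d L ⊗[ℝ] TPlus d w) :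
    T d L ⊗[ℝ] TPlus d w :=
  (T.I t k).rTensor (TPlus d w) D +
    ∑ l ∈ MI.below (Tree.deg w τ + w t - MI.size k),
      ((MI.factorial l : ℝ)⁻¹ • T.X l) ⊗ₜ[ℝ] TPlus.I w t (k + l) τ

/-- The recursive definition of `τ ↦ (τ, Δτ)`; for `τ = R_o(X^n ∏ I_{k_j}^{𝔱_j}(τ_j))`,
one has `Δτ = (R_o ⊗ Id)(ΔX^n ∏ Δ I_{k_j}^{𝔱_j}(τ_j))`. -/
noncomputable def deltaAux : Tree d L → Tree d L × (T d L ⊗[ℝ] TPlus d w) :=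
  Tree.fold fun n o s =>
    (Tree.node n o (s.map fun b => (b.1, b.2.1)),
      (T.R o).rTensor (TPlus d w)
        (deltaX w n * (s.map fun b => deltaI w b.1.1 b.1.2 b.2.1 b.2.2).prod))

/-- The value of the coproduct on a tree. -/
noncomputable def deltaTree (τ : Tree d L) : T d L ⊗[ℝ] TPlus d w := (deltaAux w τ).2

/-- The coproduct `Δ : 𝑻 → 𝑻 ⊗ 𝑻⁺`. -/
noncomputable def delta : T d L →ₗ[ℝ] T d L ⊗[ℝ] TPlus d w := T.extend (deltaTree w)

theorem deltaAux_fst (τ : Tree d L) : (deltaAux w τ).1 = τ := by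
  induction τ using Tree.ind with
  | h n o s ih =>
    rw [deltaAux, Tree.fold_node]
    show Tree.node _ _ _ = _
    congr 1
    rw [Multiset.map_map]
    conv_rhs => rw [← Multiset.map_id s]
    refine Multiset.map_congr rfl fun b hb => ?_
    exact Prod.ext rfl (ih b hb)

theorem deltaTree_node (n : MI d) (o : ODec d L) (s : Multiset (Edge d L × Tree d L)) :
    deltaTree w (Tree.node n o s) = (T.R o).rTensor (TPlus d w)
      (deltaX w n * (s.map fun b => deltaI w b.1.1 b.1.2 b.2 (deltaTree w b.2)).prod) := by
  rw [deltaTree, deltaAux, Tree.fold_node]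
  show (T.R o).rTensor (TPlus d w) _ = _
  congr 3
  rw [Multiset.map_map]
  refine Multiset.map_congr rfl fun b _ => ?_
  show deltaI w b.1.1 b.1.2 (deltaAux w b.2).1 (deltaAux w b.2).2 = _
  rw [deltaAux_fst]
  rfl

theorem delta_of (τ : Tree d L) : delta w (MonoidAlgebra.of ℝ _ τ) = deltaTree w τ :=
  T.extend_of _ _

theorem rTensor_R_apply (α : ODec d L) (x : T d L ⊗[ℝ] TPlus d w) :
    (T.R α).rTensor (TPlus d w) x =
      (MonoidAlgebra.of ℝ _ (Tree.node 0 α 0) : T d L) ⊗ₜ[ℝ] 1 * x := by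
  induction x using TensorProduct.induction_on with
  | zero => simp
  | tmul u η =>
    rw [LinearMap.rTensor_tmul, T.R_apply, Algebra.TensorProduct.tmul_mul_tmul, one_mul]
  | add x y hx hy => rw [map_add, hx, hy, mul_add]

theorem delta_node (n : MI d) (o : ODec d L) (s : Multiset (Edge d L × Tree d L)) :
    delta w (MonoidAlgebra.of ℝ _ (Tree.node n o s)) =
      (MonoidAlgebra.of ℝ _ (Tree.node 0 o 0) : T d L) ⊗ₜ[ℝ] 1 * (deltaX w n *
        (s.map fun b => deltaI w b.1.1 b.1.2 b.2 (delta w (MonoidAlgebra.of ℝ _ b.2))).prod) := by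
  simp only [delta_of, deltaTree_node, rTensor_R_apply]

/-! The following identities characterise the coproduct. -/

theorem delta_X (k : MI d) : delta w (T.X k : T d L) = deltaX w k := by
  rw [T.X, Tree.X, delta_node, Multiset.map_zero, Multiset.prod_zero, mul_one]
  exact one_mul _

theorem delta_one : delta w (1 : T d L) = 1 ⊗ₜ 1 := by
  refine (delta_X w 0).trans ?_
  simp [deltaX, Algebra.TensorProduct.one_def]

theorem delta_X_single (i : Fin d) : delta w (T.X (Finsupp.single i 1) : T d L) =
    T.X (Finsupp.single i 1) ⊗ₜ 1 + 1 ⊗ₜ MvPolynomial.X (Sum.inl i) := by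
  rw [delta_X, deltaX, Finset.prod_eq_single i]
  · simp
  · intro j _ hj
    simp [Finsupp.single_eq_of_ne hj]
  · simp

theorem delta_mul (u v : T d L) : delta w (u * v) = delta w u * delta w v := by
  have h : (LinearMap.mul ℝ (T d L)).compr₂ (delta w) =
      (LinearMap.mul ℝ (T d L ⊗[ℝ] TPlus d w)).compl₁₂ (delta w) (delta w) := by
    refine (MonoidAlgebra.basis (Tree d L) ℝ).ext fun τ =>
      (MonoidAlgebra.basis (Tree d L) ℝ).ext fun σ => ?_
    show delta w (MonoidAlgebra.of ℝ _ τ * MonoidAlgebra.of ℝ _ σ) =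
      delta w (MonoidAlgebra.of ℝ _ τ) * delta w (MonoidAlgebra.of ℝ _ σ)
    rw [← map_mul, ← Tree.node_dest τ, ← Tree.node_dest σ, Tree.node_mul_node]
    simp only [delta_node, Multiset.map_add, Multiset.prod_add]
    have h1 : ∀ n n' : MI d, deltaX (d := d) w (n + n') = deltaX w n * deltaX w n' := by
      intro n n'
      simp only [deltaX, Finsupp.add_apply, pow_add, Finset.prod_mul_distrib]
    have h2 : ∀ o o' : ODec d L,
        (MonoidAlgebra.of ℝ _ (Tree.node 0 (o + o') 0) : T d L) ⊗ₜ[ℝ] (1 : TPlus d w) =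
          (MonoidAlgebra.of ℝ _ (Tree.node 0 o 0) : T d L) ⊗ₜ[ℝ] 1 *
            (MonoidAlgebra.of ℝ _ (Tree.node 0 o' 0) : T d L) ⊗ₜ[ℝ] 1 := by
      intro o o'
      rw [Algebra.TensorProduct.tmul_mul_tmul, ← map_mul, Tree.node_mul_node]
      simp
    rw [h1, h2]
    ring
  exact LinearMap.congr_fun₂ h u v

theorem delta_I (t : L) (k : MI d) (τ : Tree d L) :
    delta w (T.I t k (MonoidAlgebra.of ℝ _ τ)) =
      (T.I t k).rTensor (TPlus d w) (delta w (MonoidAlgebra.of ℝ _ τ)) +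
        ∑ l ∈ MI.below (Tree.deg w τ + w t - MI.size k),
          ((MI.factorial l : ℝ)⁻¹ • T.X l) ⊗ₜ[ℝ] TPlus.I w t (k + l) τ := by
  rw [T.I, T.extend_of, Tree.I, delta_node, Multiset.map_singleton, Multiset.prod_singleton]
  have h : deltaX (d := d) w 0 = 1 := by simp [deltaX]
  rw [h, one_mul]
  exact one_mul _

theorem delta_R (α : ODec d L) (v : T d L) :
    delta w (T.R α v) = (T.R α).rTensor (TPlus d w) (delta w v) := by
  have h : deltaX (d := d) w 0 = 1 := by simp [deltaX]
  rw [rTensor_R_apply, T.R_apply, delta_mul, delta_node, h]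
  simp

end Coproduct

/-! ### Rules, conforming trees, and the BHZ spaces -/

/-- A (decorated, normal) rule: for each edge type `t`, it says which pairs `(N, α)` are allowed at a
node that is the upper end of an edge of type `t`, where `N` is the multiset of the labels of
the edges that leave the node upwards and `α` is the decoration `𝔬` of the node. For a normal
rule `t ↦ 𝓡 t` without `𝔬`, one takes all `(N, α)` with `N ∈ 𝓡 t` and `α` non-positive. -/
structure Rule (d : ℕ) (L : Type) where
  allowed : L → Set (Multiset (Edge d L) × ODec d L)
  /-- Normality: edges may be removed. -/
  normal : ∀ t N M α, (N, α) ∈ allowed t → M ≤ N → (M, α) ∈ allowed t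

section Spaces

variable {d : ℕ} {L : Type}

/-- `τ`, placed above an edge of type `t`, satisfies the rule at each of its nodes. -/
inductive ConformsAt (𝓡 : Rule d L) : L → Tree d L → Prop
  | node (t : L) (n : MI d) (o : ODec d L) (s : Multiset (Edge d L × Tree d L)) :
      (s.map Prod.fst, o) ∈ 𝓡.allowed t → (∀ b ∈ s, ConformsAt 𝓡 b.1.1 b.2) →
      ConformsAt 𝓡 t (Tree.node n o s)

/-- The rule is satisfied at each node, where the root may be treated as the upper end of an edge of
any type. -/
def StronglyConforms (𝓡 : Rule d L) (τ : Tree d L) : Prop := ∃ t, ConformsAt 𝓡 t τ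

/-- `T_BHZ`: the space spanned by the strongly conforming trees. -/
noncomputable abbrev TBHZ (𝓡 : Rule d L) : Submodule ℝ (T d L) :=
  MonoidAlgebra.supported ℝ ℝ {τ | StronglyConforms 𝓡 τ}

/-- The basis `B̃` of `T_BHZ`: the elements of `𝑩̃` all of whose trees strongly conform. -/
def tildeB (𝓡 : Rule d L) : Set (T d L) := {v | T.Tilde v ∧ v ∈ TBHZ 𝓡}

/-- `B̃_• = 𝑩̃_• ∩ B̃`. -/
def tildeBBullet (𝓡 : Rule d L) : Set (T d L) := {v | T.TildeBullet v} ∩ tildeB 𝓡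

/-- The trees whose root has the decoration `o` and a multiset of edges below `N`. -/
def allowedTrees (𝓡 : Rule d L) (N : Multiset (Edge d L)) (o : ODec d L) : Set (Tree d L) :=
  {σ | ∃ n s, σ = Tree.node n o s ∧ s.map Prod.fst ≤ N ∧ ∀ b ∈ s, ConformsAt 𝓡 b.1.1 b.2}

theorem X_mem_allowedTrees (𝓡 : Rule d L) (n : MI d) : Tree.X n ∈ allowedTrees 𝓡 0 0 :=
  ⟨n, 0, rfl, by simp, by simp⟩

variable [Fintype L] (w : L → ℝ) (𝓡 : Rule d L)

/-- The labels of the planted trees `I_k^𝔱(τ)` with positive homogeneity that conform, that is,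
the rule is satisfied at each node except possibly the root. -/
abbrev ConfPosPlanted : Type := {p : PosPlanted d w // ConformsAt 𝓡 p.1.1.1 p.1.2}

/-- `T_BHZ⁺`, the commutative algebra freely generated by `X_1, …, X_d` and by the conforming
planted trees with positive homogeneity. -/
noncomputable abbrev TPlusBHZ : Type := MvPolynomial (Fin d ⊕ ConfPosPlanted w 𝓡) ℝ

/-- The inclusion `T_BHZ⁺ → 𝑻⁺`. -/
noncomputable def inclPlus : TPlusBHZ w 𝓡 →ₐ[ℝ] TPlus d w :=
  MvPolynomial.rename (Sum.map id Subtype.val)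

theorem inclPlus_injective : Function.Injective (inclPlus w 𝓡) :=
  MvPolynomial.rename_injective _ (Function.Injective.sumMap Function.injective_id
    Subtype.val_injective)

/-- The inclusion `T_BHZ ⊗ T_BHZ⁺ → 𝑻 ⊗ 𝑻⁺`. -/
noncomputable def incl : TBHZ 𝓡 ⊗[ℝ] TPlusBHZ w 𝓡 →ₗ[ℝ] T d L ⊗[ℝ] TPlus d w :=
  TensorProduct.map (TBHZ 𝓡).subtype (inclPlus w 𝓡).toLinearMap

theorem incl_injective : Function.Injective (incl w 𝓡) :=
  TensorProduct.map_injective_of_flat_flat _ _ (Submodule.subtype_injective _)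
    (inclPlus_injective w 𝓡)

/-- The span of the elements `σ ⊗ η` for `σ ∈ S` and `η ∈ T_BHZ⁺`. -/
noncomputable def spanTensor (S : Set (Tree d L)) : Submodule ℝ (T d L ⊗[ℝ] TPlus d w) :=
  Submodule.span ℝ {x | ∃ σ ∈ S, ∃ η, x = MonoidAlgebra.of ℝ _ σ ⊗ₜ[ℝ] inclPlus w 𝓡 η}

theorem spanTensor_mono {S S' : Set (Tree d L)} (h : S ⊆ S') :
    spanTensor w 𝓡 S ≤ spanTensor w 𝓡 S' := by
  refine Submodule.span_mono ?_
  rintro _ ⟨σ, hσ, η, rfl⟩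
  exact ⟨σ, h hσ, η, rfl⟩

theorem tmul_mem_spanTensor {S : Set (Tree d L)} {σ : Tree d L} (hσ : σ ∈ S) (η : TPlusBHZ w 𝓡) :
    MonoidAlgebra.of ℝ _ σ ⊗ₜ[ℝ] inclPlus w 𝓡 η ∈ spanTensor w 𝓡 S :=
  Submodule.subset_span ⟨σ, hσ, η, rfl⟩

theorem mul_mem_spanTensor {N N' : Multiset (Edge d L)} {o o' : ODec d L}
    {x y : T d L ⊗[ℝ] TPlus d w} (hx : x ∈ spanTensor w 𝓡 (allowedTrees 𝓡 N o))
    (hy : y ∈ spanTensor w 𝓡 (allowedTrees 𝓡 N' o')) :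
    x * y ∈ spanTensor w 𝓡 (allowedTrees 𝓡 (N + N') (o + o')) := by
  have h := Submodule.mul_mem_mul hx hy
  rw [spanTensor, spanTensor, Submodule.span_mul_span] at h
  refine (Submodule.span_le (p := spanTensor w 𝓡 _)).2 ?_ h
  rintro _ ⟨_, ⟨σ, ⟨n, s, rfl, hs, hs'⟩, η, rfl⟩, _, ⟨σ', ⟨n', s', rfl, ht, ht'⟩, η', rfl⟩, rfl⟩
  have h : Tree.node n o s * Tree.node n' o' s' ∈ allowedTrees 𝓡 (N + N') (o + o') := by
    refine ⟨n + n', s + s', Tree.node_mul_node .., ?_, ?_⟩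
    · rw [Multiset.map_add]
      exact add_le_add hs ht
    · intro b hb
      rcases Multiset.mem_add.1 hb with hb | hb
      · exact hs' b hb
      · exact ht' b hb
  have h2 := tmul_mem_spanTensor w 𝓡 h (η * η')
  rw [map_mul, map_mul, ← Algebra.TensorProduct.tmul_mul_tmul] at h2
  exact h2

theorem rTensor_mem_spanTensor {S S' : Set (Tree d L)} (f : Tree d L → Tree d L)
    (hf : ∀ σ ∈ S, f σ ∈ S') {x : T d L ⊗[ℝ] TPlus d w} (hx : x ∈ spanTensor w 𝓡 S) :
    (T.extend fun τ => MonoidAlgebra.of ℝ _ (f τ)).rTensor (TPlus d w) x ∈ spanTensor w 𝓡 S' := by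
  have : spanTensor w 𝓡 S ≤ (spanTensor w 𝓡 S').comap
      ((T.extend fun τ => MonoidAlgebra.of ℝ _ (f τ)).rTensor (TPlus d w)) := by
    refine Submodule.span_le.2 ?_
    rintro _ ⟨σ, hσ, η, rfl⟩
    show (T.extend fun τ => MonoidAlgebra.of ℝ _ (f τ)).rTensor (TPlus d w) _ ∈ spanTensor w 𝓡 S'
    rw [LinearMap.rTensor_tmul, T.extend_of]
    exact tmul_mem_spanTensor w 𝓡 (hf σ hσ) η
  exact this hx

theorem one_mem_spanTensor : (1 : T d L ⊗[ℝ] TPlus d w) ∈ spanTensor w 𝓡 (allowedTrees 𝓡 0 0) := by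
  have h := tmul_mem_spanTensor w 𝓡 (X_mem_allowedTrees 𝓡 0) 1
  rw [map_one] at h
  exact h

theorem deltaX_mem_spanTensor (n : MI d) : deltaX w n ∈ spanTensor w 𝓡 (allowedTrees 𝓡 0 0) := by
  let A : Submonoid (T d L ⊗[ℝ] TPlus d w) :=
    { carrier := spanTensor w 𝓡 (allowedTrees 𝓡 0 0)
      mul_mem' := fun hx hy => by simpa using mul_mem_spanTensor w 𝓡 hx hy
      one_mem' := one_mem_spanTensor w 𝓡 }
  refine Submonoid.prod_mem A fun i _ => Submonoid.pow_mem A ?_ _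
  refine Submodule.add_mem _ ?_ ?_
  · have h := tmul_mem_spanTensor w 𝓡 (X_mem_allowedTrees 𝓡 (Finsupp.single i 1)) 1
    rw [map_one] at h
    exact h
  · have h := tmul_mem_spanTensor w 𝓡 (X_mem_allowedTrees 𝓡 0) (MvPolynomial.X (Sum.inl i))
    rw [inclPlus, MvPolynomial.rename_X] at h
    exact h

theorem deltaI_mem_spanTensor {t : L} {k : MI d} {τ : Tree d L} (hτ : ConformsAt 𝓡 t τ)
    {D : T d L ⊗[ℝ] TPlus d w} (hD : D ∈ spanTensor w 𝓡 {σ | ConformsAt 𝓡 t σ}) :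
    deltaI w t k τ D ∈ spanTensor w 𝓡 (allowedTrees 𝓡 {(t, k)} 0) := by
  refine Submodule.add_mem _ (rTensor_mem_spanTensor w 𝓡 _ (fun σ hσ => ?_) hD)
    (Submodule.sum_mem _ fun l _ => ?_)
  · refine ⟨0, {((t, k), σ)}, rfl, by simp, ?_⟩
    intro b hb
    rw [Multiset.mem_singleton.1 hb]
    exact hσ
  · rw [← TensorProduct.smul_tmul']
    refine Submodule.smul_mem _ _ ?_
    unfold TPlus.I
    split_ifs with h
    · have h' := tmul_mem_spanTensor w 𝓡 (X_mem_allowedTrees 𝓡 l) (MvPolynomial.X (Sum.inr ⟨⟨((t, k + l), τ), h⟩, hτ⟩))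
      rw [inclPlus, MvPolynomial.rename_X] at h'
      refine spanTensor_mono w 𝓡 ?_ h'
      rintro _ ⟨n, s, rfl, hs, hs'⟩
      exact ⟨n, s, rfl, hs.trans (Multiset.zero_le _), hs'⟩
    · rw [TensorProduct.tmul_zero]
      exact Submodule.zero_mem _

theorem deltaTree_mem_spanTensor {t : L} {τ : Tree d L} (hτ : ConformsAt 𝓡 t τ) :
    deltaTree w τ ∈ spanTensor w 𝓡 {σ | ConformsAt 𝓡 t σ} := by
  induction hτ with
  | node t n o s h hs ih =>
    rw [deltaTree_node]
    have key : ∀ u : Multiset (Edge d L × Tree d L), u ≤ s →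
        deltaX w n * (u.map fun b => deltaI w b.1.1 b.1.2 b.2 (deltaTree w b.2)).prod ∈
          spanTensor w 𝓡 (allowedTrees 𝓡 (u.map Prod.fst) 0) := by
      intro u
      induction u using Multiset.induction_on with
      | empty => intro _; simpa using deltaX_mem_spanTensor w 𝓡 n
      | cons a u ihu =>
        intro hu
        have ha : a ∈ s := Multiset.mem_of_le hu (Multiset.mem_cons_self a u)
        have h1 := ihu ((Multiset.le_cons_self u a).trans hu)
        have h2 := mul_mem_spanTensor w 𝓡 (deltaI_mem_spanTensor w 𝓡 (k := a.1.2) (hs a ha) (ih a ha)) h1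
        rw [Multiset.map_cons, Multiset.map_cons, Multiset.prod_cons, mul_left_comm]
        simpa [Multiset.singleton_add] using h2
    refine rTensor_mem_spanTensor w 𝓡 (Tree.R o) (fun σ hσ => ?_) (key s le_rfl)
    obtain ⟨n', s', rfl, h1, h2⟩ := hσ
    rw [Tree.R, Tree.dest_node]
    refine ConformsAt.node t _ _ _ ?_ h2
    rw [zero_add]
    exact 𝓡.normal t _ _ o h h1

/-- The coproduct maps `T_BHZ` to `T_BHZ ⊗ T_BHZ⁺`. -/
theorem delta_mem_range (v : TBHZ 𝓡) : delta w (v : T d L) ∈ LinearMap.range (incl w 𝓡) := by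
  have hspan : TBHZ 𝓡 = Submodule.span ℝ
      ((fun τ => MonoidAlgebra.of ℝ _ τ) '' {τ | StronglyConforms 𝓡 τ}) :=
    MonoidAlgebra.supported_eq_span_single ℝ _
  have hle : TBHZ 𝓡 ≤ (LinearMap.range (incl w 𝓡)).comap (delta w) := by
    refine hspan.le.trans (Submodule.span_le.2 ?_)
    rintro _ ⟨τ, ⟨t, hτ⟩, rfl⟩
    show delta w (MonoidAlgebra.of ℝ _ τ) ∈ LinearMap.range (incl w 𝓡)
    rw [delta, T.extend_of]
    refine (Submodule.span_le.2 ?_ : spanTensor w 𝓡 {σ | ConformsAt 𝓡 t σ} ≤ _) (deltaTree_mem_spanTensor w 𝓡 hτ)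
    rintro _ ⟨σ, hσ, η, rfl⟩
    have hmem : MonoidAlgebra.of ℝ _ σ ∈ TBHZ 𝓡 := by
      rw [hspan]
      exact Submodule.subset_span ⟨σ, ⟨t, hσ⟩, rfl⟩
    exact ⟨⟨_, hmem⟩ ⊗ₜ[ℝ] η, rfl⟩
  exact hle v.2

/-- The coproduct `Δ_BHZ : T_BHZ → T_BHZ ⊗ T_BHZ⁺`, the restriction of `Δ : 𝑻 → 𝑻 ⊗ 𝑻⁺`. -/
noncomputable def deltaBHZ : TBHZ 𝓡 →ₗ[ℝ] TBHZ 𝓡 ⊗[ℝ] TPlusBHZ w 𝓡 :=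
  (LinearEquiv.ofInjective (incl w 𝓡) (incl_injective w 𝓡)).symm.toLinearMap ∘ₗ
    ((delta w).domRestrict (TBHZ 𝓡)).codRestrict _ (delta_mem_range w 𝓡)

theorem incl_deltaBHZ (v : TBHZ 𝓡) : incl w 𝓡 (deltaBHZ w 𝓡 v) = delta w (v : T d L) :=
  congrArg Subtype.val ((LinearEquiv.ofInjective (incl w 𝓡) (incl_injective w 𝓡)).apply_symm_apply
    ⟨delta w (v : T d L), delta_mem_range w 𝓡 v⟩)

/-- Assumption (D) for a basis `b` of `T_BHZ` and a subset `bullet` of it: for `τ` in this subset,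
there is no term `σ ⊗ X^k` with `k ≠ 0` in the expansion of `Δτ` in the basis that consists
of all `σ ⊗ η`, with `σ` in the basis `b` and `η` a monomial in `X_1, …, X_d` and the planted trees. -/
def AssumptionD {ι : Type} (b : Module.Basis ι ℝ (TBHZ 𝓡)) (bullet : Set ι) : Prop :=
  ∀ τ ∈ bullet, ∀ (σ : ι) (k : MI d), k ≠ 0 →
    (b.tensorProduct (MvPolynomial.basisMonomials (Fin d ⊕ ConfPosPlanted w 𝓡) ℝ)).repr
      (deltaBHZ w 𝓡 (b τ)) (σ, k.mapDomain Sum.inl) = 0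

end Spaces
end BHZ

namespace BHZ

/-! The twisted operators are a triangular change of basis that is its own inverse. For fixed `v`,
the family `ℓ ↦ _ℓ I(v)` is the binomial transform of `ℓ ↦ I(X^ℓ v)`. Write a family `f` as the
linear functional on polynomials over `𝑻` with `Y^ℓ ↦ f ℓ`; the transform then evaluates this
functional at `(X - Y)^ℓ`. Since `X - (X - Y) = Y`, the transform is an involution
(`binomialTransform_binomialTransform`).

Replacing, at every edge of a tree, `I(X^ℓ σ)` by `_ℓ I(σ)`, where `X^ℓ` is the root decoration of
the subtree, turns trees into elements of `𝑩̃`, and all of them arise in this way. The map is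
multiplicative, hence extends to an algebra endomorphism `toTilde` of `𝑻`. The involution supplies a
two-sided inverse `ofTilde`, so `𝑩̃` is a basis indexed by trees. Both maps only move decorations
`𝔫` between nodes: they preserve the homogeneity and the tree stripped of `𝔫` (`homogeneousPart`).
Conformity depends only on the stripped tree, so the bijection with trees restricts to `T_BHZ`, and
reading off the root decoration gives the factorisation `X^k τ`.

For (D), project `𝑻⁺` onto the polynomials by killing the planted trees. The projected coproduct
commutes with `I`, is multiplicative, and sends `X_i` to `X_i ⊗ 1 + 1 ⊗ X_i`. In the recursion
`_{ℓ+e_i} I(v) = X_i · _ℓ I(v) - _ℓ I(X_i v)` the two contributions of `1 ⊗ X_i` cancel, so the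
projected coproduct commutes with every `_ℓ I`. Hence it maps each `τ ∈ 𝑩̃_•` to `τ ⊗ 1`
(`deltaPoly_of_tildeBullet`), which leaves no term `σ ⊗ X^k` with `k ≠ 0`. -/

theorem MI.prod_add_pow {d : ℕ} {A : Type*} [CommRing A] (x y : Fin d → A) (l : MI d) :
    ∏ i, (x i + y i) ^ l i = ∑ p ∈ Finset.HasAntidiagonal.antidiagonal l,
      (MI.binom l p.1 : A) * ((∏ i, x i ^ p.1 i) * ∏ i, y i ^ p.2 i) := by
  have h : ∀ (a b : A) (n : ℕ), (a + b) ^ n =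
      ∑ m ∈ Finset.HasAntidiagonal.antidiagonal n, (n.choose m.1 : A) * (a ^ m.1 * b ^ m.2) := fun a b n => by
    simp only [(Commute.all a b).add_pow', nsmul_eq_mul]
  simp only [h, Finset.prod_univ_sum]
  symm
  -- A splitting of `l` into two multi-indices is the same as a choice, for each coordinate, of a
  -- splitting of `l i`.
  refine Finset.sum_bij' (fun p _ i => (p.1 i, p.2 i))
    (fun q _ => (Finsupp.equivFunOnFinite.symm fun i => (q i).1,
      Finsupp.equivFunOnFinite.symm fun i => (q i).2)) ?_ ?_ ?_ ?_ ?_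
  · intro p hp
    rw [Finset.HasAntidiagonal.mem_antidiagonal] at hp
    simp [← hp]
  · intro q hq
    rw [Finset.HasAntidiagonal.mem_antidiagonal]
    ext i
    simpa using Fintype.mem_piFinset.1 hq i
  · intro p _
    ext <;> simp
  · intro q _
    ext <;> simp
  · intro p _
    simp [Finset.prod_mul_distrib, MI.binom]

/-! ### The binomial transform and the twisted operators -/

namespace T
variable {d : ℕ} {L : Type}

theorem X_zero : (X 0 : T d L) = 1 := rfl

theorem X_add (k l : MI d) : (X (k + l) : T d L) = X k * X l := by
  simp [X, Tree.X, Tree.node_mul_node]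

theorem prod_X_single_pow (k : MI d) :
    ∏ i, (X (Finsupp.single i 1) : T d L) ^ k i = X k := by
  let f : Multiplicative (MI d) →* T d L :=
    { toFun := fun k => X k.toAdd, map_one' := X_zero, map_mul' := fun a b => X_add _ _ }
  have h : ∀ k : MI d, X k = f (Multiplicative.ofAdd k) := fun _ => rfl
  simp only [h, ← map_pow, ← map_prod, ← ofAdd_nsmul, ← ofAdd_sum]
  congr 2
  ext i
  simp

/-- `ℓ ↦ ∑_m (ℓ choose m) X^m (-1)^{ℓ-m} f(ℓ-m)`. -/
noncomputable def binomialTransform (f : MI d → T d L) (l : MI d) : T d L :=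
  ∑ p ∈ Finset.HasAntidiagonal.antidiagonal l,
    ((MI.binom l p.1 : ℝ) * (-1) ^ MI.size p.2) • (X p.1 * f p.2)

/-- The linear map on polynomials over `𝑻` that maps the monomial `Y^ℓ` to `f(ℓ)`. -/
noncomputable def umbral (f : MI d → T d L) : MvPolynomial (Fin d) (T d L) →ₗ[T d L] T d L :=
  (MvPolynomial.basisMonomials (Fin d) (T d L)).constr (T d L) f

theorem umbral_monomial (f : MI d → T d L) (l : MI d) :
    umbral f (MvPolynomial.monomial l 1) = f l := by
  have := (MvPolynomial.basisMonomials (Fin d) (T d L)).constr_basis (T d L) f l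
  simpa [umbral] using this

theorem prod_X_pow (l : MI d) :
    ∏ i, (MvPolynomial.X i : MvPolynomial (Fin d) (T d L)) ^ l i = MvPolynomial.monomial l 1 := by
  rw [MvPolynomial.monomial_eq, Finsupp.prod_fintype _ _ (by simp)]
  simp

/-- The multi-index binomial theorem with `y = -q`; linearity over `𝑻`, not just over `ℝ`, lets the
factors `X^m` leave the functional. General `q` is needed so that the transform can be iterated. -/
theorem umbral_prod_sub (f : MI d → T d L) (q : Fin d → MvPolynomial (Fin d) (T d L)) (l : MI d) :
    umbral f (∏ i, (MvPolynomial.C (X (Finsupp.single i 1)) - q i) ^ l i) =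
      binomialTransform (fun m => umbral f (∏ i, q i ^ m i)) l := by
  simp only [sub_eq_add_neg]
  rw [MI.prod_add_pow, map_sum, binomialTransform]
  refine Finset.sum_congr rfl fun p _ => ?_
  have h : ∏ i, (-q i) ^ p.2 i = (-1) ^ MI.size p.2 * ∏ i, q i ^ p.2 i := by
    simp only [neg_pow (q _), Finset.prod_mul_distrib, Finset.prod_pow_eq_pow_sum, MI.size]
  have h2 : (MI.binom l p.1 : MvPolynomial (Fin d) (T d L)) *
      ((∏ i, MvPolynomial.C (X (Finsupp.single i 1)) ^ p.1 i) * ∏ i, (-q i) ^ p.2 i) =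
      (((MI.binom l p.1 : ℝ) * (-1) ^ MI.size p.2) • X p.1 : T d L) • ∏ i, q i ^ p.2 i := by
    rw [h, MvPolynomial.smul_eq_C_mul, ← prod_X_single_pow, Algebra.smul_def]
    simp only [map_mul, map_prod, map_pow, map_natCast, map_neg, map_one]
    ring
  rw [h2, map_smul, smul_eq_mul, smul_mul_assoc]

theorem binomialTransform_eq_umbral (f : MI d → T d L) (l : MI d) : binomialTransform f l =
    umbral f (∏ i, (MvPolynomial.C (X (Finsupp.single i 1)) - MvPolynomial.X i) ^ l i) := by
  simp only [umbral_prod_sub, prod_X_pow, umbral_monomial]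

/-- Taking `q = X - Y` in `umbral_prod_sub` expresses the second transform through `(X - (X - Y))^ℓ
= Y^ℓ`. -/
theorem binomialTransform_binomialTransform (f : MI d → T d L) :
    binomialTransform (binomialTransform f) = f := by
  funext l
  have h : binomialTransform f = fun m => umbral f
      (∏ i, (MvPolynomial.C (X (Finsupp.single i 1)) - MvPolynomial.X i) ^ m i) :=
    funext (binomialTransform_eq_umbral f)
  rw [h, ← umbral_prod_sub]
  simp only [sub_sub_cancel, prod_X_pow, umbral_monomial]

theorem twistedI_eq (l : MI d) (t : L) (k : MI d) (v : T d L) :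
    twistedI l t k v = binomialTransform (fun m => I t k (X m * v)) l := rfl

theorem binomialTransform_twistedI (l : MI d) (t : L) (k : MI d) (v : T d L) :
    binomialTransform (fun m => twistedI m t k v) l = I t k (X l * v) :=
  congrFun (binomialTransform_binomialTransform fun m => I t k (X m * v)) l

theorem umbral_mul_X (f : MI d → T d L) (i : Fin d) (p : MvPolynomial (Fin d) (T d L)) :
    umbral f (p * MvPolynomial.X i) = umbral (fun m => f (m + Finsupp.single i 1)) p := by
  have h : umbral f ∘ₗ LinearMap.mulRight (T d L) (MvPolynomial.X i) =
      umbral (fun m => f (m + Finsupp.single i 1)) := by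
    refine (MvPolynomial.basisMonomials (Fin d) (T d L)).ext fun m => ?_
    simp [umbral_monomial, MvPolynomial.X, MvPolynomial.monomial_mul]
  exact LinearMap.congr_fun h p

theorem twistedI_zero (t : L) (k : MI d) (v : T d L) : twistedI 0 t k v = I t k v := by
  simp [twistedI, MI.binom, MI.size, X_zero]

/-- Split one factor `X_i - Y_i` off `(X - Y)^{ℓ+e_i}`: the `X_i` comes out in front by linearity,
while `Y_i` shifts the index, which puts an `X_i` under `I`. This recursion drives the coproduct
computation. -/
theorem twistedI_add_single (l : MI d) (i : Fin d) (t : L) (k : MI d) (v : T d L) :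
    twistedI (l + Finsupp.single i 1) t k v =
      X (Finsupp.single i 1) * twistedI l t k v - twistedI l t k (X (Finsupp.single i 1) * v) := by
  have h : ∏ j, (MvPolynomial.C (X (Finsupp.single j 1)) - MvPolynomial.X j :
        MvPolynomial (Fin d) (T d L)) ^ (l + Finsupp.single i 1 : MI d) j =
      (∏ j, (MvPolynomial.C (X (Finsupp.single j 1)) - MvPolynomial.X j) ^ l j) *
        (MvPolynomial.C (X (Finsupp.single i 1)) - MvPolynomial.X i) := by
    simp only [Finsupp.add_apply, pow_add, Finset.prod_mul_distrib]
    congr 1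
    rw [Finset.prod_eq_single i] <;> simp +contextual [eq_comm]
  simp only [twistedI_eq, binomialTransform_eq_umbral, h, mul_sub, map_sub, umbral_mul_X,
    X_add, mul_assoc]
  congr 1
  rw [mul_comm _ (MvPolynomial.C _), ← MvPolynomial.smul_eq_C_mul, map_smul, smul_eq_mul]

/-- `_ℓ I_k^𝔱` as a linear map. -/
noncomputable def twistedILinear (l : MI d) (t : L) (k : MI d) : T d L →ₗ[ℝ] T d L where
  toFun := twistedI l t k
  map_add' u v := by simp [twistedI, mul_add, Finset.sum_add_distrib]
  map_smul' c v := by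
    simp only [twistedI, mul_smul_comm, map_smul, Finset.smul_sum, RingHom.id_apply]
    exact Finset.sum_congr rfl fun p _ => smul_comm _ _ _

theorem twistedILinear_apply (l : MI d) (t : L) (k : MI d) (v : T d L) :
    twistedILinear l t k v = twistedI l t k v := rfl

theorem I_of (t : L) (k : MI d) (τ : Tree d L) :
    I t k (MonoidAlgebra.of ℝ _ τ) = MonoidAlgebra.of ℝ _ (Tree.I t k τ) := extend_of _ _

/-- Expresses a tree through operations that the algebra maps below respect, so that they can be
computed branch by branch. -/
theorem of_node (n : MI d) (o : ODec d L) (s : Multiset (Edge d L × Tree d L)) :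
    (MonoidAlgebra.of ℝ _ (Tree.node n o s) : T d L) =
      X n * (MonoidAlgebra.of ℝ _ (Tree.node 0 o 0) *
        (s.map fun b => I b.1.1 b.1.2 (MonoidAlgebra.of ℝ _ b.2)).prod) := by
  have h : ∀ s : Multiset (Edge d L × Tree d L),
      (s.map fun b => I b.1.1 b.1.2 (MonoidAlgebra.of ℝ _ b.2) : Multiset (T d L)).prod =
        MonoidAlgebra.of ℝ _ (Tree.node 0 0 s) := by
    intro s
    induction s using Multiset.induction_on with
    | empty => rfl
    | cons a s ih =>
      rw [Multiset.map_cons, Multiset.prod_cons, ih, I_of, ← map_mul, Tree.I,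
        Tree.node_mul_node, zero_add, zero_add, Multiset.singleton_add]
  rw [h, X, Tree.X, ← map_mul, ← map_mul, Tree.node_mul_node, Tree.node_mul_node]
  simp

/-! ### The change of basis and its inverse -/

/-- The element of `𝑩̃_•` with the branches of `τ`, obtained by replacing each `I_k^𝔱(X^ℓ σ)`
in `τ` by `_ℓ I_k^𝔱(σ)`, paired with the decoration `𝔫` of the root. -/
noncomputable def tildeBulletAux : Tree d L → MI d × T d L :=
  Tree.fold fun n o s => (n, MonoidAlgebra.of ℝ _ (Tree.node 0 o 0) *
    (s.map fun b => twistedI b.2.1 b.1.1 b.1.2 b.2.2).prod)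

/-- The element of `𝑩̃_•` with the branches of `τ`. -/
noncomputable def tildeBullet (τ : Tree d L) : T d L := (tildeBulletAux τ).2

theorem tildeBullet_node (n : MI d) (o : ODec d L) (s : Multiset (Edge d L × Tree d L)) :
    tildeBullet (Tree.node n o s) = MonoidAlgebra.of ℝ _ (Tree.node 0 o 0) *
      (s.map fun b => twistedI b.2.dest.1.1 b.1.1 b.1.2 (tildeBullet b.2)).prod := by
  have h : ∀ τ : Tree d L, (tildeBulletAux τ).1 = τ.dest.1.1 := by
    intro τ
    conv_lhs => rw [← Tree.node_dest τ]
    rw [tildeBulletAux, Tree.fold_node]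
  rw [tildeBullet, tildeBulletAux, Tree.fold_node]
  show _ * _ = _
  rw [Multiset.map_map]
  congr 2
  refine Multiset.map_congr rfl fun b _ => ?_
  rw [← h]
  rfl

theorem tildeBullet_mul (τ σ : Tree d L) :
    tildeBullet (τ * σ) = tildeBullet τ * tildeBullet σ := by
  rw [← Tree.node_dest τ, ← Tree.node_dest σ, Tree.node_mul_node]
  simp only [tildeBullet_node, Multiset.map_add, Multiset.prod_add]
  have h : (MonoidAlgebra.of ℝ _ (Tree.node 0 (τ.dest.1.2 + σ.dest.1.2) 0) : T d L) =
      MonoidAlgebra.of ℝ _ (Tree.node 0 τ.dest.1.2 0) *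
        MonoidAlgebra.of ℝ _ (Tree.node 0 σ.dest.1.2 0) := by
    rw [← map_mul, Tree.node_mul_node, add_zero, add_zero]
  rw [h]
  ring

theorem tildeBullet_node_zero (n : MI d) (o : ODec d L) :
    tildeBullet (Tree.node n o 0) = (MonoidAlgebra.of ℝ _ (Tree.node 0 o 0) : T d L) := by
  simp [tildeBullet_node]

theorem tildeBullet_I (t : L) (k : MI d) (τ : Tree d L) :
    tildeBullet (Tree.I t k τ) = twistedI τ.dest.1.1 t k (tildeBullet τ) := by
  rw [Tree.I, tildeBullet_node, Multiset.map_singleton, Multiset.prod_singleton]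
  exact one_mul _

/-- The element `X^n ψ` of `𝑩̃` that belongs to `τ`. -/
noncomputable def tildeOf : Tree d L →* T d L where
  toFun τ := X τ.dest.1.1 * tildeBullet τ
  map_one' := by
    rw [Tree.one_def, tildeBullet_node_zero, Tree.dest_node, X_zero, one_mul]
    rfl
  map_mul' τ σ := by
    have h : (τ * σ).dest.1.1 = τ.dest.1.1 + σ.dest.1.1 := by
      conv_lhs => rw [← Tree.node_dest τ, ← Tree.node_dest σ, Tree.node_mul_node, Tree.dest_node]
    rw [tildeBullet_mul, h, X_add, mul_mul_mul_comm]

theorem tildeOf_eq (τ : Tree d L) : tildeOf τ = X τ.dest.1.1 * tildeBullet τ := rfl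

theorem tildeOf_node (n : MI d) (o : ODec d L) (s : Multiset (Edge d L × Tree d L)) :
    tildeOf (Tree.node n o s) = X n * tildeBullet (Tree.node 0 o s) := by
  rw [tildeOf_eq, Tree.dest_node, tildeBullet_node, tildeBullet_node]

theorem tildeOf_I (t : L) (k : MI d) (τ : Tree d L) :
    tildeOf (Tree.I t k τ) = twistedI τ.dest.1.1 t k (tildeBullet τ) := by
  rw [tildeOf_eq, tildeBullet_I, Tree.I, Tree.dest_node, X_zero, one_mul]

/-- The algebra endomorphism `τ ↦ tildeOf τ`. -/
noncomputable def toTilde : T d L →ₐ[ℝ] T d L := MonoidAlgebra.lift ℝ _ _ tildeOf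

theorem toTilde_of (τ : Tree d L) : toTilde (MonoidAlgebra.of ℝ _ τ) = tildeOf τ :=
  MonoidAlgebra.lift_of _ _

theorem toTilde_X (k : MI d) : toTilde (X k : T d L) = X k := by
  rw [X, toTilde_of, Tree.X, tildeOf_node, tildeBullet_node_zero]
  exact mul_one _

theorem toTilde_of_node_zero (o : ODec d L) :
    toTilde (MonoidAlgebra.of ℝ _ (Tree.node 0 o 0) : T d L) =
      MonoidAlgebra.of ℝ _ (Tree.node 0 o 0) := by
  rw [toTilde_of, tildeOf_node, tildeBullet_node_zero, X_zero, one_mul]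

/-- The linear map `X^ℓ σ ↦ _ℓ I_k^𝔱(σ)`, for the trees `σ` whose root has no decoration `𝔫`. -/
noncomputable def rootTwistedI (t : L) (k : MI d) : T d L →ₗ[ℝ] T d L :=
  extend fun τ => twistedI τ.dest.1.1 t k (MonoidAlgebra.of ℝ _ (Tree.node 0 τ.dest.1.2 τ.dest.2))

theorem X_mul_of_node (l n : MI d) (o : ODec d L) (s : Multiset (Edge d L × Tree d L)) :
    X l * MonoidAlgebra.of ℝ _ (Tree.node n o s) = MonoidAlgebra.of ℝ _ (Tree.node (l + n) o s) := by
  rw [X, Tree.X, ← map_mul, Tree.node_mul_node, zero_add, zero_add]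

theorem rootTwistedI_of (t : L) (k n : MI d) (o : ODec d L) (s : Multiset (Edge d L × Tree d L)) :
    rootTwistedI t k (MonoidAlgebra.of ℝ _ (Tree.node n o s)) =
      twistedI n t k (MonoidAlgebra.of ℝ _ (Tree.node 0 o s)) := by
  rw [rootTwistedI, extend_of, Tree.dest_node]

/-- The value on a tree of the inverse of `toTilde`. -/
noncomputable def untildeOf : Tree d L → T d L :=
  Tree.fold fun n o s => X n * (MonoidAlgebra.of ℝ _ (Tree.node 0 o 0) *
    (s.map fun b => rootTwistedI b.1.1 b.1.2 b.2).prod)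

theorem untildeOf_node (n : MI d) (o : ODec d L) (s : Multiset (Edge d L × Tree d L)) :
    untildeOf (Tree.node n o s) = X n * (MonoidAlgebra.of ℝ _ (Tree.node 0 o 0) *
      (s.map fun b => rootTwistedI b.1.1 b.1.2 (untildeOf b.2)).prod) := by
  rw [untildeOf, Tree.fold_node, Multiset.map_map]
  rfl

/-- The inverse of `toTilde`. -/
noncomputable def ofTilde : T d L →ₐ[ℝ] T d L := MonoidAlgebra.lift ℝ _ _
  { toFun := untildeOf
    map_one' := by
      rw [Tree.one_def, untildeOf_node, X_zero, one_mul, Multiset.map_zero, Multiset.prod_zero,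
        mul_one]
      rfl
    map_mul' := fun τ σ => by
      rw [← Tree.node_dest τ, ← Tree.node_dest σ, Tree.node_mul_node]
      simp only [untildeOf_node, Multiset.map_add, Multiset.prod_add]
      have h : (MonoidAlgebra.of ℝ _ (Tree.node 0 (τ.dest.1.2 + σ.dest.1.2) 0) : T d L) =
          MonoidAlgebra.of ℝ _ (Tree.node 0 τ.dest.1.2 0) *
            MonoidAlgebra.of ℝ _ (Tree.node 0 σ.dest.1.2 0) := by
        rw [← map_mul, Tree.node_mul_node, add_zero, add_zero]
      rw [h, X_add]
      ring }

theorem ofTilde_of (τ : Tree d L) : ofTilde (MonoidAlgebra.of ℝ _ τ) = untildeOf τ :=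
  MonoidAlgebra.lift_of _ _

theorem ofTilde_X (k : MI d) : ofTilde (X k : T d L) = X k := by
  rw [X, ofTilde_of, Tree.X, untildeOf_node, Multiset.map_zero, Multiset.prod_zero]
  exact congrArg _ (mul_one _) |>.trans (mul_one _)

theorem ofTilde_of_node_zero (o : ODec d L) :
    ofTilde (MonoidAlgebra.of ℝ _ (Tree.node 0 o 0) : T d L) =
      MonoidAlgebra.of ℝ _ (Tree.node 0 o 0) := by
  rw [ofTilde_of, untildeOf_node, Multiset.map_zero, Multiset.prod_zero, X_zero, one_mul, mul_one]

/-- This intertwining relation replaces a direct description of `ofTilde` on trees. -/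
theorem ofTilde_I (t : L) (k : MI d) (v : T d L) :
    ofTilde (I t k v) = rootTwistedI t k (ofTilde v) := by
  have h : ofTilde.toLinearMap ∘ₗ I t k = rootTwistedI t k ∘ₗ (ofTilde (d := d)).toLinearMap := by
    refine (MonoidAlgebra.basis (Tree d L) ℝ).ext fun τ => ?_
    show ofTilde (I t k (MonoidAlgebra.of ℝ _ τ)) =
      rootTwistedI t k (ofTilde (MonoidAlgebra.of ℝ _ τ))
    rw [I_of, ofTilde_of, ofTilde_of, Tree.I, untildeOf_node, Multiset.map_singleton,
      Multiset.prod_singleton, X_zero, one_mul]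
    exact one_mul _
  exact LinearMap.congr_fun h v

theorem map_binomialTransform (φ : T d L →ₐ[ℝ] T d L) (hφ : ∀ m, φ (X m) = X m)
    (f : MI d → T d L) (l : MI d) :
    φ (binomialTransform f l) = binomialTransform (fun m => φ (f m)) l := by
  simp only [binomialTransform, map_sum, map_smul, map_mul, hφ]

/-- By induction, `ofTilde` sends `X^m` times the image of a branch to `X^m σ`, with `σ` the branch
without its root decoration. It therefore sends the twisted factor to the binomial transform of `m ↦
_m I(σ)`, which the involution turns back into `I(X^ℓ σ)`, the original branch. The root decoration
`𝔫` is lost since `tildeBullet` ignores it. -/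
theorem ofTilde_tildeBullet (τ : Tree d L) :
    ofTilde (tildeBullet τ) = MonoidAlgebra.of ℝ _ (Tree.node 0 τ.dest.1.2 τ.dest.2) := by
  induction τ using Tree.ind with
  | h n o s ih =>
    rw [tildeBullet_node, Tree.dest_node, of_node 0 o s, X_zero, one_mul]
    simp only [map_mul, ofTilde_of_node_zero, map_multiset_prod, Multiset.map_map]
    congr 2
    refine Multiset.map_congr rfl fun b hb => ?_
    show ofTilde (twistedI b.2.dest.1.1 b.1.1 b.1.2 (tildeBullet b.2)) = _
    rw [twistedI_eq, map_binomialTransform _ ofTilde_X]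
    simp only [ofTilde_I, map_mul, ofTilde_X, ih b hb, X_mul_of_node, rootTwistedI_of, add_zero]
    rw [binomialTransform_twistedI, X_mul_of_node, add_zero, Tree.node_dest]

theorem ofTilde_toTilde (v : T d L) : ofTilde (toTilde v) = v := by
  have h : ofTilde.toLinearMap ∘ₗ (toTilde (d := d) (L := L)).toLinearMap = LinearMap.id := by
    refine (MonoidAlgebra.basis (Tree d L) ℝ).ext fun τ => ?_
    show ofTilde (toTilde (MonoidAlgebra.of ℝ _ τ)) = MonoidAlgebra.of ℝ _ τ
    rw [toTilde_of, tildeOf_eq, map_mul, ofTilde_X, ofTilde_tildeBullet, X_mul_of_node, add_zero,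
      Tree.node_dest]
  exact LinearMap.congr_fun h v

/-- The mirror image of `ofTilde_I`, again by the involution: `toTilde` turns `_ℓ I(σ)` into the
binomial transform of twisted operators, which collapses to `I` applied to `X^ℓ` times the image of
`σ`. -/
theorem toTilde_rootTwistedI (t : L) (k : MI d) (v : T d L) :
    toTilde (rootTwistedI t k v) = I t k (toTilde v) := by
  have h : toTilde.toLinearMap ∘ₗ rootTwistedI t k = I t k ∘ₗ (toTilde (d := d)).toLinearMap := by
    refine (MonoidAlgebra.basis (Tree d L) ℝ).ext fun τ => ?_
    show toTilde (rootTwistedI t k (MonoidAlgebra.of ℝ _ τ)) =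
      I t k (toTilde (MonoidAlgebra.of ℝ _ τ))
    rw [← Tree.node_dest τ, rootTwistedI_of, toTilde_of, tildeOf_node, twistedI_eq,
      map_binomialTransform _ toTilde_X, ← binomialTransform_twistedI]
    congr 1
    funext m
    rw [X_mul_of_node, add_zero, I_of, toTilde_of, tildeOf_I, Tree.dest_node, tildeBullet_node,
      tildeBullet_node]
  exact LinearMap.congr_fun h v

theorem toTilde_ofTilde (v : T d L) : toTilde (ofTilde v) = v := by
  have h : toTilde.toLinearMap ∘ₗ (ofTilde (d := d) (L := L)).toLinearMap = LinearMap.id := by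
    refine (MonoidAlgebra.basis (Tree d L) ℝ).ext fun τ => ?_
    show toTilde (ofTilde (MonoidAlgebra.of ℝ _ τ)) = MonoidAlgebra.of ℝ _ τ
    rw [ofTilde_of]
    induction τ using Tree.ind with
    | h n o s ih =>
      rw [untildeOf_node, of_node n o s]
      simp only [map_mul, toTilde_X, toTilde_of_node_zero, map_multiset_prod, Multiset.map_map]
      congr 3
      refine Multiset.map_congr rfl fun b hb => ?_
      rw [Function.comp_apply, toTilde_rootTwistedI, ih b hb]
  exact LinearMap.congr_fun h v

end T

/-! ### Trees stripped of the node decorations `𝔫` -/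

namespace Tree
variable {d : ℕ} {L : Type}

/-- The tree `τ` without its decorations `𝔫`. -/
noncomputable def erase : Tree d L → Tree d L := fold fun _ o s => node 0 o s

theorem erase_node (n : MI d) (o : ODec d L) (s : Multiset (Edge d L × Tree d L)) :
    erase (node n o s) = node 0 o (s.map fun b => (b.1, erase b.2)) := fold_node _ _ _ _

theorem erase_mul (τ σ : Tree d L) : erase (τ * σ) = erase τ * erase σ := by
  rw [← node_dest τ, ← node_dest σ, node_mul_node]
  simp only [erase_node, node_mul_node, Multiset.map_add, add_zero]

theorem deg_mul [Fintype L] (w : L → ℝ) (τ σ : Tree d L) :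
    deg w (τ * σ) = deg w τ + deg w σ := by
  rw [← node_dest τ, ← node_dest σ, node_mul_node]
  simp only [deg_node, Multiset.map_add, Multiset.sum_add, MI.size, oSize, Finsupp.add_apply,
    Prod.fst_add, Prod.snd_add, Pi.add_apply, Finset.sum_add_distrib, add_mul, Nat.cast_add,
    Int.cast_add]
  ring

/-- A rule looks only at edge labels and at `𝔬`. -/
theorem conformsAt_erase {𝓡 : Rule d L} {t : L} {τ : Tree d L} :
    ConformsAt 𝓡 t (erase τ) ↔ ConformsAt 𝓡 t τ := by
  have key : ∀ {t : L} {n : MI d} {o : ODec d L} {s : Multiset (Edge d L × Tree d L)},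
      ConformsAt 𝓡 t (node n o s) ↔
        (s.map Prod.fst, o) ∈ 𝓡.allowed t ∧ ∀ b ∈ s, ConformsAt 𝓡 b.1.1 b.2 := by
    intro t n o s
    refine ⟨fun h => ?_, fun h => .node t n o s h.1 h.2⟩
    -- Trees live in a quotient and `node` is not a constructor, so its arguments have to be
    -- recovered through `dest`.
    generalize hτ : node n o s = τ at h
    obtain ⟨_, n', o', s', h1, h2⟩ := h
    have := congrArg dest hτ
    simp only [dest_node, Prod.mk.injEq] at this
    obtain ⟨⟨rfl, rfl⟩, rfl⟩ := this
    exact ⟨h1, h2⟩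
  induction τ using Tree.ind generalizing t with
  | h n o s ih =>
    rw [erase_node, key, key, Multiset.map_map]
    simp only [Function.comp_def, Multiset.mem_map, forall_exists_index, and_imp,
      forall_apply_eq_imp_iff₂]
    exact and_congr Iff.rfl (forall₂_congr fun b hb => ih b hb)

theorem stronglyConforms_of_erase_eq {𝓡 : Rule d L} {τ σ : Tree d L} (h : erase τ = erase σ)
    (hσ : StronglyConforms 𝓡 σ) : StronglyConforms 𝓡 τ := by
  obtain ⟨t, ht⟩ := hσ
  exact ⟨t, conformsAt_erase.1 (h ▸ conformsAt_erase.2 ht)⟩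

end Tree

/-! ### `𝑩̃` as the image of the trees -/

namespace T
variable {d : ℕ} {L : Type}

theorem tildeBullet_tildeBullet (τ : Tree d L) : TildeBullet (tildeBullet τ) := by
  induction τ using Tree.ind with
  | h n o s ih =>
    rw [tildeBullet_node, ← R_apply]
    refine .R _ _ ?_
    clear o
    induction s using Multiset.induction_on with
    | empty => exact .one
    | cons a s ihs =>
      rw [Multiset.map_cons, Multiset.prod_cons]
      exact .mul _ _ (.twistedI _ _ _ _ (ih a (Multiset.mem_cons_self a s)))
        (ihs fun b hb => ih b (Multiset.mem_cons_of_mem hb))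

theorem tildeBullet_node_eq (n n' : MI d) (o : ODec d L) (s : Multiset (Edge d L × Tree d L)) :
    tildeBullet (Tree.node n o s) = tildeBullet (Tree.node n' o s) := by
  rw [tildeBullet_node, tildeBullet_node]

theorem TildeBullet.exists_eq {v : T d L} (h : TildeBullet v) : ∃ τ, v = tildeBullet τ := by
  induction h with
  | one => exact ⟨Tree.node 0 0 0, (tildeBullet_node_zero 0 0).symm⟩
  | twistedI l t k v _ ih =>
    obtain ⟨τ, rfl⟩ := ih
    -- The index `l` becomes the root decoration of the subtree; overwriting the old one is
    -- harmless, as `tildeBullet` does not see it.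
    refine ⟨Tree.I t k (Tree.node l τ.dest.1.2 τ.dest.2), ?_⟩
    rw [tildeBullet_I, Tree.dest_node, tildeBullet_node_eq l τ.dest.1.1, Tree.node_dest]
  | R α v _ ih =>
    obtain ⟨τ, rfl⟩ := ih
    exact ⟨Tree.node 0 α 0 * τ, by rw [R_apply, tildeBullet_mul, tildeBullet_node_zero]⟩
  | mul u v _ _ ihu ihv =>
    obtain ⟨τ, rfl⟩ := ihu
    obtain ⟨σ, rfl⟩ := ihv
    exact ⟨τ * σ, (tildeBullet_mul τ σ).symm⟩

theorem X_mul_tildeBullet (k : MI d) (τ : Tree d L) :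
    X k * tildeBullet τ = tildeOf (Tree.node k τ.dest.1.2 τ.dest.2) := by
  rw [tildeOf_node, tildeBullet_node_eq 0 τ.dest.1.1, Tree.node_dest]

theorem tilde_tildeOf (τ : Tree d L) : Tilde (tildeOf τ) :=
  ⟨_, _, tildeBullet_tildeBullet τ, rfl⟩

theorem Tilde.exists_eq {v : T d L} (h : Tilde v) : ∃ τ, v = tildeOf τ := by
  obtain ⟨k, u, hu, rfl⟩ := h
  obtain ⟨τ, rfl⟩ := hu.exists_eq
  exact ⟨_, X_mul_tildeBullet k τ⟩

theorem tildeOf_injective : Function.Injective (tildeOf : Tree d L → T d L) := by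
  intro τ σ h
  have h2 := congrArg ofTilde h
  rw [← toTilde_of, ← toTilde_of, ofTilde_toTilde, ofTilde_toTilde] at h2
  exact MonoidAlgebra.of_injective h2

/-! ### Preservation of homogeneity and of the stripped tree -/

section Homogeneous
variable [Fintype L] (w : L → ℝ)

/-- The span of the trees of homogeneity `β` that become `ε` without their decorations `𝔫`. -/
noncomputable abbrev homogeneousPart (ε : Tree d L) (β : ℝ) : Submodule ℝ (T d L) :=
  MonoidAlgebra.supported ℝ ℝ {τ | τ.erase = ε ∧ τ.deg w = β}

theorem of_mem_homogeneousPart {τ ε : Tree d L} {β : ℝ} (h : τ.erase = ε) (h' : τ.deg w = β) :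
    MonoidAlgebra.of ℝ _ τ ∈ homogeneousPart w ε β := by
  rw [homogeneousPart, MonoidAlgebra.supported_eq_span_single]
  exact Submodule.subset_span ⟨τ, ⟨h, h'⟩, rfl⟩

theorem map_mem_of_mem_homogeneousPart {ε : Tree d L} {β : ℝ} {V : Type} [AddCommGroup V]
    [Module ℝ V] (f : T d L →ₗ[ℝ] V) {S : Submodule ℝ V}
    (hf : ∀ τ : Tree d L, τ.erase = ε → τ.deg w = β → f (MonoidAlgebra.of ℝ _ τ) ∈ S)
    {v : T d L} (hv : v ∈ homogeneousPart w ε β) : f v ∈ S := by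
  have : homogeneousPart w ε β ≤ S.comap f := by
    rw [homogeneousPart, MonoidAlgebra.supported_eq_span_single]
    refine Submodule.span_le.2 ?_
    rintro _ ⟨τ, ⟨h, h'⟩, rfl⟩
    exact hf τ h h'
  exact this hv

theorem mul_mem_homogeneousPart {ε ε' : Tree d L} {β β' : ℝ} {u v : T d L}
    (hu : u ∈ homogeneousPart w ε β) (hv : v ∈ homogeneousPart w ε' β') :
    u * v ∈ homogeneousPart w (ε * ε') (β + β') := by
  refine map_mem_of_mem_homogeneousPart w (LinearMap.mulRight ℝ v) (fun τ h h' => ?_) hu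
  refine map_mem_of_mem_homogeneousPart w (LinearMap.mulLeft ℝ (MonoidAlgebra.of ℝ _ τ))
    (fun σ g g' => ?_) hv
  rw [LinearMap.mulLeft_apply, ← map_mul]
  exact of_mem_homogeneousPart w (by rw [Tree.erase_mul, h, g]) (by rw [Tree.deg_mul, h', g'])

theorem X_mem_homogeneousPart (k : MI d) : (X k : T d L) ∈ homogeneousPart w 1 (MI.size k) := by
  refine of_mem_homogeneousPart w ?_ ?_
  · rw [Tree.X, Tree.erase_node]
    rfl
  · simp [Tree.X, Tree.deg_node, Tree.oSize]

theorem X_mul_mem_homogeneousPart (k : MI d) {ε : Tree d L} {β : ℝ} {v : T d L}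
    (hv : v ∈ homogeneousPart w ε β) : X k * v ∈ homogeneousPart w ε (MI.size k + β) := by
  simpa only [one_mul] using mul_mem_homogeneousPart w (X_mem_homogeneousPart w k) hv

theorem I_mem_homogeneousPart (t : L) (k : MI d) {ε : Tree d L} {β : ℝ} {v : T d L}
    (hv : v ∈ homogeneousPart w ε β) :
    I t k v ∈ homogeneousPart w (Tree.I t k ε) (w t - MI.size k + β) := by
  refine map_mem_of_mem_homogeneousPart w _ (fun τ h h' => ?_) hv
  rw [I_of]
  refine of_mem_homogeneousPart w ?_ ?_
  · rw [Tree.I, Tree.erase_node, Multiset.map_singleton, h]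
    rfl
  · simp [Tree.I, Tree.deg_node, Tree.oSize, h', MI.size]

/-- Each term distributes `ℓ = m + (ℓ - m)` over the two ends of the new edge, so the total
decoration is the same in all terms. -/
theorem twistedI_mem_homogeneousPart (l : MI d) (t : L) (k : MI d) {ε : Tree d L} {β : ℝ}
    {v : T d L} (hv : v ∈ homogeneousPart w ε β) :
    twistedI l t k v ∈ homogeneousPart w (Tree.I t k ε) (w t - MI.size k + (MI.size l + β)) := by
  refine Submodule.sum_mem _ fun p hp => Submodule.smul_mem _ _ ?_
  have h := X_mul_mem_homogeneousPart w p.1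
    (I_mem_homogeneousPart w t k (X_mul_mem_homogeneousPart w p.2 hv))
  convert h using 2
  rw [← Finset.HasAntidiagonal.mem_antidiagonal.1 hp]
  simp only [MI.size, Finsupp.add_apply, Finset.sum_add_distrib, Nat.cast_add]
  ring

/-- The common inductive step for the change of basis and for its inverse, which differ only in the
factor `f` at each branch. -/
theorem prod_mem_homogeneousPart (n : MI d) (o : ODec d L)
    (s : Multiset (Edge d L × Tree d L)) (f : Edge d L × Tree d L → T d L)
    (hf : ∀ b ∈ s, f b ∈ homogeneousPart w (Tree.I b.1.1 b.1.2 b.2.erase)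
      (w b.1.1 - MI.size b.1.2 + b.2.deg w)) :
    X n * (MonoidAlgebra.of ℝ _ (Tree.node 0 o 0) * (s.map f).prod) ∈
      homogeneousPart w (Tree.node n o s).erase ((Tree.node n o s).deg w) := by
  have h : (s.map f).prod ∈ homogeneousPart w (Tree.node 0 0 s).erase ((Tree.node 0 0 s).deg w) := by
    induction s using Multiset.induction_on with
    | empty =>
      exact of_mem_homogeneousPart w rfl rfl
    | cons a s ih =>
      have h1 := mul_mem_homogeneousPart w (hf a (Multiset.mem_cons_self a s))
        (ih fun b hb => hf b (Multiset.mem_cons_of_mem hb))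
      rw [Multiset.map_cons, Multiset.prod_cons]
      convert h1 using 2
      · rw [Tree.erase_node, Tree.erase_node, Tree.I, Tree.node_mul_node, Multiset.map_cons,
          Multiset.singleton_add, zero_add, zero_add]
      · simp [Tree.deg_node, MI.size, Tree.oSize]
  have h0 : MonoidAlgebra.of ℝ _ (Tree.node 0 o 0) ∈
      homogeneousPart w (Tree.node 0 o 0).erase ((Tree.node 0 o 0 : Tree d L).deg w) :=
    of_mem_homogeneousPart w rfl rfl
  have h2 := X_mul_mem_homogeneousPart w n (mul_mem_homogeneousPart w h0 h)
  convert h2 using 2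
  · simp [Tree.erase_node, Tree.node_mul_node]
  · simp [Tree.deg_node, MI.size, Tree.oSize]
    ring

theorem tildeBullet_mem_homogeneousPart (τ : Tree d L) :
    tildeBullet τ ∈ homogeneousPart w τ.erase (τ.deg w - MI.size τ.dest.1.1) := by
  induction τ using Tree.ind with
  | h n o s ih =>
    have h := prod_mem_homogeneousPart w 0 o s
      (fun b => twistedI b.2.dest.1.1 b.1.1 b.1.2 (tildeBullet b.2)) fun b hb => by
        have := twistedI_mem_homogeneousPart w b.2.dest.1.1 b.1.1 b.1.2 (ih b hb)
        rwa [add_sub_cancel] at this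
    rw [tildeBullet_node]
    rw [X_zero, one_mul] at h
    convert h using 2
    · rw [Tree.erase_node, Tree.erase_node]
    · simp [Tree.deg_node, Tree.dest_node, MI.size]
      ring

theorem tildeOf_mem_homogeneousPart (τ : Tree d L) :
    tildeOf τ ∈ homogeneousPart w τ.erase (τ.deg w) := by
  have h := X_mul_mem_homogeneousPart w τ.dest.1.1 (tildeBullet_mem_homogeneousPart w τ)
  rwa [add_sub_cancel] at h

theorem rootTwistedI_mem_homogeneousPart (t : L) (k : MI d) {ε : Tree d L} {β : ℝ} {v : T d L}
    (hv : v ∈ homogeneousPart w ε β) :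
    rootTwistedI t k v ∈ homogeneousPart w (Tree.I t k ε) (w t - MI.size k + β) := by
  refine map_mem_of_mem_homogeneousPart w _ (fun τ h h' => ?_) hv
  obtain ⟨l, o, s, rfl⟩ : ∃ l o s, τ = Tree.node l o s := ⟨_, _, _, (Tree.node_dest τ).symm⟩
  rw [rootTwistedI_of]
  have h0 : MonoidAlgebra.of ℝ _ (Tree.node 0 o s) ∈ homogeneousPart w ε (β - MI.size l) := by
    refine of_mem_homogeneousPart w ?_ ?_
    · rw [← h, Tree.erase_node, Tree.erase_node]
    · rw [← h', Tree.deg_node, Tree.deg_node]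
      simp [MI.size]
      ring
  have := twistedI_mem_homogeneousPart w l t k h0
  rwa [add_sub_cancel] at this

theorem untildeOf_mem_homogeneousPart (τ : Tree d L) :
    untildeOf τ ∈ homogeneousPart w τ.erase (τ.deg w) := by
  induction τ using Tree.ind with
  | h n o s ih =>
    rw [untildeOf_node]
    exact prod_mem_homogeneousPart w n o s _ fun b hb =>
      rootTwistedI_mem_homogeneousPart w b.1.1 b.1.2 (ih b hb)

theorem homogeneousPart_le (𝓡 : Rule d L) {τ : Tree d L} (hτ : StronglyConforms 𝓡 τ) (β : ℝ) :
    homogeneousPart w τ.erase β ≤ TBHZ 𝓡 :=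
  MonoidAlgebra.supported_mono fun _ h => Tree.stronglyConforms_of_erase_eq h.1 hτ

/-- All trees occurring in `tildeOf τ` have the stripped tree of `τ`, so they conform exactly when
`τ` does. The forward direction needs at least one such tree, hence `tildeOf τ ≠ 0`. -/
theorem tildeOf_mem_TBHZ_iff {𝓡 : Rule d L} {τ : Tree d L} :
    tildeOf τ ∈ TBHZ 𝓡 ↔ StronglyConforms 𝓡 τ := by
  -- Only the stripped tree matters here, so the weight `w = 0` serves.
  refine ⟨fun h => ?_, fun h => homogeneousPart_le 0 𝓡 h _ (tildeOf_mem_homogeneousPart 0 τ)⟩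
  have h0 : tildeOf τ ≠ 0 := by
    intro h
    rw [← toTilde_of] at h
    have h2 := congrArg ofTilde h
    rw [ofTilde_toTilde, map_zero] at h2
    exact Finsupp.single_ne_zero.2 one_ne_zero (congrArg MonoidAlgebra.coeff h2)
  have h1 : (tildeOf τ).coeff ≠ 0 := fun h => h0 (MonoidAlgebra.coeff_injective h)
  obtain ⟨σ, hσ⟩ := Finsupp.support_nonempty_iff.2 h1
  exact Tree.stronglyConforms_of_erase_eq (tildeOf_mem_homogeneousPart 0 τ hσ).1.symm (h hσ)

end Homogeneous

end T

/-! ### The polynomial part of the coproduct -/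

section Polynomial
variable {d : ℕ} {L : Type} [Fintype L] (w : L → ℝ)

/-- The projection of `𝑻⁺` to the polynomials in `X_1, …, X_d`, which maps the planted trees to `0`. -/
noncomputable def polyPart : TPlus d w →ₐ[ℝ] MvPolynomial (Fin d) ℝ :=
  MvPolynomial.killCompl Sum.inl_injective

theorem killCompl_X_inl {β : Type} (i : Fin d) :
    MvPolynomial.killCompl (Sum.inl_injective (α := Fin d) (β := β))
      (MvPolynomial.X (Sum.inl i) : MvPolynomial (Fin d ⊕ β) ℝ) = MvPolynomial.X i := by
  rw [← MvPolynomial.rename_X, MvPolynomial.killCompl_rename_app]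

theorem killCompl_X_inr {β : Type} (j : β) :
    MvPolynomial.killCompl (Sum.inl_injective (α := Fin d) (β := β))
      (MvPolynomial.X (Sum.inr j) : MvPolynomial (Fin d ⊕ β) ℝ) = 0 := by
  rw [MvPolynomial.killCompl, MvPolynomial.aeval_X, dif_neg (by simp)]

theorem polyPart_I (t : L) (k : MI d) (τ : Tree d L) : polyPart w (TPlus.I w t k τ) = 0 := by
  unfold TPlus.I
  split_ifs
  · exact killCompl_X_inr _
  · exact map_zero _

/-- The coproduct, followed by the projection of `𝑻⁺` to the polynomials. -/
noncomputable def deltaPoly : T d L →ₗ[ℝ] T d L ⊗[ℝ] MvPolynomial (Fin d) ℝ :=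
  (polyPart w).toLinearMap.lTensor (T d L) ∘ₗ delta w

theorem deltaPoly_mul (u v : T d L) : deltaPoly w (u * v) = deltaPoly w u * deltaPoly w v := by
  have h : ∀ x : T d L ⊗[ℝ] TPlus d w, (polyPart w).toLinearMap.lTensor (T d L) x =
      Algebra.TensorProduct.map (AlgHom.id ℝ (T d L)) (polyPart w) x := fun _ => rfl
  simp only [deltaPoly, LinearMap.comp_apply, delta_mul, h, map_mul]

theorem deltaPoly_one : deltaPoly w (1 : T d L) = 1 ⊗ₜ 1 := by
  rw [deltaPoly, LinearMap.comp_apply, delta_one, LinearMap.lTensor_tmul]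
  congr 1
  exact map_one (polyPart w)

theorem deltaPoly_X_single (i : Fin d) : deltaPoly w (T.X (Finsupp.single i 1) : T d L) =
    T.X (Finsupp.single i 1) ⊗ₜ 1 + 1 ⊗ₜ MvPolynomial.X i := by
  rw [deltaPoly, LinearMap.comp_apply, delta_X_single, map_add, LinearMap.lTensor_tmul,
    LinearMap.lTensor_tmul, AlgHom.toLinearMap_apply, AlgHom.toLinearMap_apply, map_one,
    polyPart, killCompl_X_inl]

theorem deltaPoly_R (α : ODec d L) (v : T d L) :
    deltaPoly w (T.R α v) = (T.R α).rTensor _ (deltaPoly w v) := by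
  rw [deltaPoly, LinearMap.comp_apply, delta_R, LinearMap.comp_apply, ← LinearMap.comp_apply,
    LinearMap.lTensor_comp_rTensor, ← LinearMap.rTensor_comp_lTensor, LinearMap.comp_apply]

/-- The correction terms in `Δ I(τ)` all carry a planted tree on the right, which the projection
kills. -/
theorem deltaPoly_I (t : L) (k : MI d) (v : T d L) :
    deltaPoly w (T.I t k v) = (T.I t k).rTensor _ (deltaPoly w v) := by
  have h : deltaPoly w ∘ₗ T.I t k = (T.I t k).rTensor _ ∘ₗ deltaPoly w := by
    refine (MonoidAlgebra.basis (Tree d L) ℝ).ext fun τ => ?_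
    show deltaPoly w (T.I t k (MonoidAlgebra.of ℝ _ τ)) =
      (T.I t k).rTensor _ (deltaPoly w (MonoidAlgebra.of ℝ _ τ))
    rw [deltaPoly, LinearMap.comp_apply, delta_I, map_add, map_sum, Finset.sum_eq_zero, add_zero,
      LinearMap.comp_apply, ← LinearMap.comp_apply, LinearMap.lTensor_comp_rTensor,
      ← LinearMap.rTensor_comp_lTensor, LinearMap.comp_apply]
    intro l _
    rw [LinearMap.lTensor_tmul, AlgHom.toLinearMap_apply, polyPart_I, TensorProduct.tmul_zero]
  exact LinearMap.congr_fun h v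

/-- Induction on `ℓ`, one unit vector at a time, starting from `deltaPoly_I` at `ℓ = 0`. -/
theorem deltaPoly_twistedI (l : MI d) (t : L) (k : MI d) (v : T d L) :
    deltaPoly w (T.twistedI l t k v) = (T.twistedILinear l t k).rTensor _ (deltaPoly w v) := by
  have step : ∀ (l : MI d) (i : Fin d),
      (∀ v : T d L, deltaPoly w (T.twistedI l t k v) =
        (T.twistedILinear l t k).rTensor _ (deltaPoly w v)) →
      ∀ v : T d L, deltaPoly w (T.twistedI (l + Finsupp.single i 1) t k v) =
        (T.twistedILinear (l + Finsupp.single i 1) t k).rTensor _ (deltaPoly w v) := by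
    intro l i h v
    rw [T.twistedI_add_single, map_sub, deltaPoly_mul, h, h, deltaPoly_mul, deltaPoly_X_single]
    induction deltaPoly w v using TensorProduct.induction_on with
    | zero => simp only [map_zero, mul_zero, sub_zero]
    | add x y hx hy => rw [map_add, map_add, mul_add, mul_add, map_add, ← hx, ← hy]; abel
    -- Both products contribute `_ℓ I(u) ⊗ X_i p`, and these cancel in the difference; what remains
    -- is the recursion for `_{ℓ+e_i} I(u)`, tensored with `p`.
    | tmul u p =>
      rw [add_mul, add_mul]
      simp only [LinearMap.rTensor_tmul, Algebra.TensorProduct.tmul_mul_tmul, map_add, one_mul,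
        T.twistedILinear_apply, T.twistedI_add_single, TensorProduct.sub_tmul]
      abel
  -- The arbitrary starting index `m` allows the additive induction on `l` to chain increments.
  have key : ∀ l m : MI d, (∀ v : T d L, deltaPoly w (T.twistedI m t k v) =
        (T.twistedILinear m t k).rTensor _ (deltaPoly w v)) →
      ∀ v : T d L, deltaPoly w (T.twistedI (m + l) t k v) =
        (T.twistedILinear (m + l) t k).rTensor _ (deltaPoly w v) := by
    intro l
    induction l using Finsupp.induction_linear with
    | zero => intro m h; rwa [add_zero]
    | add l l' ih ih' => intro m h; rw [← add_assoc]; exact ih' _ (ih m h)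
    | single i n =>
      induction n with
      | zero => intro m h; rwa [Finsupp.single_zero, add_zero]
      | succ n ih => intro m h; rw [Finsupp.single_add, ← add_assoc]; exact step _ i (ih m h)
  have h0 : T.twistedILinear (0 : MI d) t k = T.I t k :=
    LinearMap.ext fun v => T.twistedI_zero t k v
  have := key l 0 (fun v => by rw [T.twistedI_zero, h0, deltaPoly_I]) v
  rwa [zero_add] at this

theorem deltaPoly_of_tildeBullet {v : T d L} (hv : T.TildeBullet v) :
    deltaPoly w v = v ⊗ₜ 1 := by
  induction hv with
  | one => exact deltaPoly_one w
  | twistedI l t k v _ ih =>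
    rw [deltaPoly_twistedI, ih, LinearMap.rTensor_tmul, T.twistedILinear_apply]
  | R α v _ ih => rw [deltaPoly_R, ih, LinearMap.rTensor_tmul]
  | mul u v _ _ ihu ihv =>
    rw [deltaPoly_mul, ihu, ihv, Algebra.TensorProduct.tmul_mul_tmul, one_mul]

end Polynomial

/-! ### Assumption (D) and the basis of `T_BHZ` -/

section Spaces
variable {d : ℕ} {L : Type} [Fintype L] (w : L → ℝ) (𝓡 : Rule d L)

/-- The projection of `T_BHZ⁺` to the polynomials in `X_1, …, X_d`. -/
noncomputable def polyPartBHZ : TPlusBHZ w 𝓡 →ₐ[ℝ] MvPolynomial (Fin d) ℝ :=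
  MvPolynomial.killCompl Sum.inl_injective

theorem polyPart_inclPlus (η : TPlusBHZ w 𝓡) :
    polyPart w (inclPlus w 𝓡 η) = polyPartBHZ w 𝓡 η := by
  have h : (polyPart w).comp (inclPlus w 𝓡) = polyPartBHZ w 𝓡 := by
    refine MvPolynomial.algHom_ext fun i => ?_
    rw [AlgHom.comp_apply, inclPlus, MvPolynomial.rename_X, polyPart, polyPartBHZ]
    rcases i with i | i
    · exact (killCompl_X_inl i).trans (killCompl_X_inl i).symm
    · exact (killCompl_X_inr _).trans (killCompl_X_inr i).symm
  exact AlgHom.congr_fun h η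

/-- By flatness `T_BHZ ⊗ ℝ[X]` embeds into `𝑻 ⊗ ℝ[X]`, where the identity is
`deltaPoly_of_tildeBullet`. -/
theorem lTensor_polyPartBHZ_deltaBHZ {v : TBHZ 𝓡} (hv : T.TildeBullet (v : T d L)) :
    (polyPartBHZ w 𝓡).toLinearMap.lTensor (TBHZ 𝓡) (deltaBHZ w 𝓡 v) = v ⊗ₜ 1 := by
  have h : ∀ x, (TBHZ 𝓡).subtype.rTensor _ ((polyPartBHZ w 𝓡).toLinearMap.lTensor (TBHZ 𝓡) x) =
      (polyPart w).toLinearMap.lTensor (T d L) (incl w 𝓡 x) := by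
    intro x
    induction x using TensorProduct.induction_on with
    | zero => simp only [map_zero]
    | add x y hx hy => simp only [map_add, hx, hy]
    | tmul u η =>
      rw [LinearMap.lTensor_tmul, LinearMap.rTensor_tmul, incl, TensorProduct.map_tmul,
        LinearMap.lTensor_tmul, AlgHom.toLinearMap_apply, AlgHom.toLinearMap_apply,
        AlgHom.toLinearMap_apply, polyPart_inclPlus]
  refine Module.Flat.rTensor_preserves_injective_linearMap (TBHZ 𝓡).subtype
    (Submodule.subtype_injective _) ?_
  rw [h, incl_deltaBHZ, LinearMap.rTensor_tmul]
  exact deltaPoly_of_tildeBullet w hv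

/-- Killing the planted trees leaves the coefficients of the pure monomials `X^k` unchanged, so (D)
can be tested after the projection. -/
theorem repr_mapDomain_inl {ι : Type} (b : Module.Basis ι ℝ (TBHZ 𝓡)) (σ : ι) (k : MI d)
    (x : TBHZ 𝓡 ⊗[ℝ] TPlusBHZ w 𝓡) :
    (b.tensorProduct (MvPolynomial.basisMonomials (Fin d ⊕ ConfPosPlanted w 𝓡) ℝ)).repr x
        (σ, k.mapDomain Sum.inl) =
      (b.tensorProduct (MvPolynomial.basisMonomials (Fin d) ℝ)).repr
        ((polyPartBHZ w 𝓡).toLinearMap.lTensor (TBHZ 𝓡) x) (σ, k) := by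
  induction x using TensorProduct.induction_on with
  | zero => simp only [map_zero, Finsupp.zero_apply]
  | add x y hx hy => simp only [map_add, Finsupp.add_apply, hx, hy]
  | tmul u η =>
    rw [LinearMap.lTensor_tmul, Module.Basis.tensorProduct_repr_tmul_apply,
      Module.Basis.tensorProduct_repr_tmul_apply]
    congr 1
    exact (MvPolynomial.coeff_killCompl Sum.inl_injective).symm

theorem assumptionD {ι : Type} (b : Module.Basis ι ℝ (TBHZ 𝓡)) (bullet : Set ι)
    (h : ∀ τ ∈ bullet, T.TildeBullet (b τ : T d L)) : AssumptionD w 𝓡 b bullet := by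
  intro τ hτ σ k hk
  rw [repr_mapDomain_inl, lTensor_polyPartBHZ_deltaBHZ w 𝓡 (h τ hτ),
    Module.Basis.tensorProduct_repr_tmul_apply]
  have h1 : (MvPolynomial.basisMonomials (Fin d) ℝ).repr 1 k = 0 := by
    show MvPolynomial.coeff k 1 = 0
    rw [MvPolynomial.coeff_one, if_neg hk.symm]
  rw [h1]
  simp

/-- The restriction of `toTilde` to `T_BHZ`. -/
noncomputable def toTildeBHZ : TBHZ 𝓡 ≃ₗ[ℝ] TBHZ 𝓡 :=
  have h : ∀ v ∈ TBHZ 𝓡, T.toTilde v ∈ TBHZ 𝓡 := fun v hv => by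
    rw [TBHZ, MonoidAlgebra.supported_eq_span_single] at hv
    refine (Submodule.span_le (p := (TBHZ 𝓡).comap T.toTilde.toLinearMap)).2 ?_ hv
    rintro _ ⟨τ, hτ, rfl⟩
    show T.toTilde (MonoidAlgebra.of ℝ _ τ) ∈ TBHZ 𝓡
    rw [T.toTilde_of]
    exact T.tildeOf_mem_TBHZ_iff.2 hτ
  have h' : ∀ v ∈ TBHZ 𝓡, T.ofTilde v ∈ TBHZ 𝓡 := fun v hv => by
    rw [TBHZ, MonoidAlgebra.supported_eq_span_single] at hv
    refine (Submodule.span_le (p := (TBHZ 𝓡).comap T.ofTilde.toLinearMap)).2 ?_ hv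
    rintro _ ⟨τ, hτ, rfl⟩
    show T.ofTilde (MonoidAlgebra.of ℝ _ τ) ∈ TBHZ 𝓡
    rw [T.ofTilde_of]
    exact T.homogeneousPart_le 0 𝓡 hτ _ (T.untildeOf_mem_homogeneousPart 0 τ)
  LinearEquiv.ofLinearMap (T.toTilde.toLinearMap.restrict h) (T.ofTilde.toLinearMap.restrict h')
    (LinearMap.ext fun v => Subtype.ext (T.toTilde_ofTilde _))
    (LinearMap.ext fun v => Subtype.ext (T.ofTilde_toTilde _))

theorem coe_toTildeBHZ (v : TBHZ 𝓡) : (toTildeBHZ 𝓡 v : T d L) = T.toTilde v := rfl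

/-- The strongly conforming trees correspond to the elements of `B̃`. -/
noncomputable def treeEquivTildeB : {τ : Tree d L | StronglyConforms 𝓡 τ} ≃ tildeB 𝓡 :=
  Equiv.ofBijective (fun τ => ⟨T.tildeOf τ.1, T.tilde_tildeOf _, T.tildeOf_mem_TBHZ_iff.2 τ.2⟩) <| by
    refine ⟨fun τ σ h => Subtype.ext (T.tildeOf_injective (congrArg Subtype.val h)), ?_⟩
    rintro ⟨v, hv, hv'⟩
    obtain ⟨τ, rfl⟩ := hv.exists_eq
    exact ⟨⟨τ, T.tildeOf_mem_TBHZ_iff.1 hv'⟩, rfl⟩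

/-- The basis `B̃` of `T_BHZ`. -/
noncomputable def tildeBasis : Module.Basis (tildeB 𝓡) ℝ (TBHZ 𝓡) :=
  ((Module.Basis.ofRepr (MonoidAlgebra.supportedEquivFinsupp
    {τ : Tree d L | StronglyConforms 𝓡 τ})).map (toTildeBHZ 𝓡)).reindex (treeEquivTildeB 𝓡)

theorem coe_tildeBasis (v : tildeB 𝓡) : (tildeBasis 𝓡 v : T d L) = v := by
  obtain ⟨τ, rfl⟩ := (treeEquivTildeB 𝓡).surjective v
  rw [tildeBasis, Module.Basis.reindex_apply, Equiv.symm_apply_apply, Module.Basis.map_apply,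
    coe_toTildeBHZ]
  have h : ((Module.Basis.ofRepr (MonoidAlgebra.supportedEquivFinsupp
      {τ : Tree d L | StronglyConforms 𝓡 τ}) τ : TBHZ 𝓡) : T d L) = MonoidAlgebra.of ℝ _ τ.1 := by
    simp [MonoidAlgebra.supportedEquivFinsupp]
  rw [h, T.toTilde_of]
  rfl

/-- Each `X^k u` is `tildeOf` of a tree with root decoration `k`. As `tildeOf` is injective, `k` and
the rest of the tree, hence `u`, are determined; conformity does not depend on `k`. -/
theorem bijOn_tildeB : Set.BijOn (fun p : MI d × T d L => T.X p.1 * p.2)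
    (Set.univ ×ˢ tildeBBullet 𝓡) (tildeB 𝓡) := by
  have key : ∀ (k : MI d) (τ : Tree d L), StronglyConforms 𝓡 (Tree.node k τ.dest.1.2 τ.dest.2) ↔
      StronglyConforms 𝓡 τ := by
    intro k τ
    have h : (Tree.node k τ.dest.1.2 τ.dest.2).erase = τ.erase := by
      conv_rhs => rw [← Tree.node_dest τ]
      rw [Tree.erase_node, Tree.erase_node]
    exact ⟨Tree.stronglyConforms_of_erase_eq h.symm, Tree.stronglyConforms_of_erase_eq h⟩
  have key' : ∀ (k : MI d) (τ : Tree d L), T.X k * T.tildeBullet τ ∈ TBHZ 𝓡 ↔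
      StronglyConforms 𝓡 τ := by
    intro k τ
    rw [T.X_mul_tildeBullet, T.tildeOf_mem_TBHZ_iff, key]
  refine ⟨?_, ?_, ?_⟩
  · rintro ⟨k, u⟩ ⟨-, hu, -, hu'⟩
    obtain ⟨τ, rfl⟩ := T.TildeBullet.exists_eq hu
    refine ⟨⟨k, _, hu, rfl⟩, (key' k τ).2 ((key' 0 τ).1 ?_)⟩
    rwa [T.X_zero, one_mul]
  · rintro ⟨k, u⟩ ⟨-, hu, -, -⟩ ⟨k', u'⟩ ⟨-, hu', -, -⟩ h
    obtain ⟨τ, rfl⟩ := T.TildeBullet.exists_eq hu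
    obtain ⟨τ', rfl⟩ := T.TildeBullet.exists_eq hu'
    simp only [T.X_mul_tildeBullet] at h
    have h2 := congrArg Tree.dest (T.tildeOf_injective h)
    simp only [Tree.dest_node, Prod.mk.injEq] at h2
    obtain ⟨⟨rfl, h3⟩, h4⟩ := h2
    refine Prod.ext rfl ?_
    show T.tildeBullet τ = T.tildeBullet τ'
    rw [← Tree.node_dest τ, ← Tree.node_dest τ', h3, h4]
    exact T.tildeBullet_node_eq _ _ _ _
  · rintro _ ⟨⟨k, u, hu, rfl⟩, h⟩
    refine ⟨(k, u), ⟨Set.mem_univ _, hu, ⟨0, u, hu, ?_⟩, ?_⟩, rfl⟩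
    · rw [T.X_zero, one_mul]
    · obtain ⟨τ, rfl⟩ := T.TildeBullet.exists_eq hu
      have := (key' 0 τ).2 ((key' k τ).1 h)
      rwa [T.X_zero, one_mul] at this

end Spaces
end BHZ

theorem mainTheorem5 (d : ℕ) {L : Type} [Fintype L] (w : L → ℝ) (𝓡 : BHZ.Rule d L) :
    ∃ b : Module.Basis (BHZ.tildeB 𝓡) ℝ (BHZ.TBHZ 𝓡),
      (∀ v : BHZ.tildeB 𝓡, (b v : BHZ.T d L) = v) ∧
      (∀ v : BHZ.tildeB 𝓡, ∃ β : ℝ, BHZ.T.IsHomogeneous w β (v : BHZ.T d L)) ∧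
      Set.BijOn (fun p : BHZ.MI d × BHZ.T d L => BHZ.T.X p.1 * p.2)
        (Set.univ ×ˢ BHZ.tildeBBullet 𝓡) (BHZ.tildeB 𝓡) ∧
      BHZ.AssumptionD w 𝓡 b {v | (v : BHZ.T d L) ∈ BHZ.tildeBBullet 𝓡} := by
  refine ⟨BHZ.tildeBasis 𝓡, BHZ.coe_tildeBasis 𝓡, ?_, BHZ.bijOn_tildeB 𝓡,
    BHZ.assumptionD w 𝓡 _ _ fun v hv => ?_⟩
  · rintro ⟨v, hv, -⟩
    obtain ⟨τ, rfl⟩ := hv.exists_eq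
    exact ⟨τ.deg w, fun σ hσ => (BHZ.T.tildeOf_mem_homogeneousPart w τ hσ).2⟩
  · rw [BHZ.coe_tildeBasis]
    exact hv.1
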